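/- **Theorem 3.1 (skew Cauchy identity).** Let $q,s$ be complex parameters. For $x\in\mathbb C$, $sx\neq 1$, define vertex weights $L_x(I,j;K,\ell)$ and $M_x(I,j;K,\ell)$, where $j,\ell\in\{0,1\}$ are the left and right horizontal path numbers and $I,K\in\mathbb Z_{\ge0}$ the bottom and top vertical path numbers of a vertex, by $$L_x(I,0;I,0)=\tfrac{1-sxq^I}{1-sx},\quad L_x(I,1;I,1)=\tfrac{x-sq^I}{1-sx},\quad L_x(I,1;I+1,0)=\tfrac{1-q^{I+1}}{1-sx},\quad L_x(I+1,0;I,1)=\tfrac{x(1-s^2q^I)}{1-sx},$$ $$M_x(I,0;I,0)=\tfrac{x-sq^I}{1-sx},\quad M_x(I,1;I,1)=\tfrac{1-sxq^I}{1-sx},\quad M_x(I,1;I+1,0)=\tfrac{x(1-q^{I+1})}{1-sx},\quad M_x(I+1,0;I,1)=\tfrac{1-s^2q^I}{1-sx},$$ all other weights being $0$. For a partition $\kappa$ let $m_i(\kappa)$ be the number of its parts equal to $i$. For partitions $\beta,\tau$ let $$\langle\beta|\mathcal T(x)|\tau\rangle=\sum_{h}\prod_{i\ge1}L_x\big(m_i(\beta),h_i;m_i(\tau),h_{i-1}\big),\qquad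 \langle\beta|\mathcal T^*(x)|\tau\rangle=\sum_{h}\prod_{i\ge1}M_x\big(m_i(\beta),h_i;m_i(\tau),h_{i-1}\big),$$ where $h=(h_0,h_1,\dots)$ runs over the sequences in $\{0,1\}$ with $h_i=0$ for all large $i$ in the case of $\mathcal T$, and with $h_i=1$ for all large $i$ in the case of $\mathcal T^*$ ($h_0$ is free). The skew stable spin Hall–Littlewood functions and their duals are $$f_{\mu/\nu}(x_1,\dots,x_m)=\langle\mu|\mathcal T(x_m)\cdots\mathcal T(x_1)|\nu\rangle,\qquad g_{\mu/\nu}(y_1,\dots,y_n)=\langle\nu|\mathcal T^*(y_1)\cdots\mathcal T^*(y_n)|\mu\rangle,$$ products being expanded over the basis of all partitions (these are finite sums). Let $m,n\ge1$ and let $x_1,\dots,x_m,y_1,\dots,y_n$ be complex numbers such that, for all $i,j$, $$|(x_i-s)(y_j-s)|<|(1-sx_i)(1-sy_j)|\qquad\text{and}\qquad qx_iy_j\neq1 .$$ Then for all partitions $\lambda,\mu$ both sums below converge absolutely and $$\prod_{i=1}^m\prod_{j=1}^n\frac{1-x_iy_j}{1-qx_iy_j}\sum_\kappa g_{\kappa/\lambda}(y_1,\dots,y_n)\,f_{\kappa/\mu}(x_1,\dots,x_m)=\sum_\nu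 f_{\lambda/\nu}(x_1,\dots,x_m)\,g_{\mu/\nu}(y_1,\dots,y_n),$$ where $\kappa$ and $\nu$ run over all partitions. -/

import Mathlib

namespace SSHL

noncomputable section

/-- The set of all partitions (of all natural numbers), the empty partition included. -/
abbrev Ptn : Type := Σ n : ℕ, Nat.Partition n

/-- `mult κ i = m_i(κ)` is the number of parts of `κ` equal to `i`: the partition `κ` is
`1 ^ m_1(κ) 2 ^ m_2(κ) ⋯`. It is the number of paths of the state `κ` on the vertical line
with abscissa `-i`, for `i ≥ 1`. -/
def mult (κ : Ptn) (i : ℕ) : ℕ := κ.2.parts.count i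

/-- Weight `L_{x,s}(I, j; K, l)` of a vertex of type 1 with spectral parameter `x`:
`I` paths come in from below, `j` from the left, `K` leave at the top, `l` to the right. -/
def weightL (q s x : ℂ) (I : ℕ) (j : Fin 2) (K : ℕ) (l : Fin 2) : ℂ :=
  if j = 0 ∧ l = 0 ∧ K = I then (1 - s * x * q ^ I) / (1 - s * x)
  else if j = 1 ∧ l = 1 ∧ K = I then (x - s * q ^ I) / (1 - s * x)
  else if j = 1 ∧ l = 0 ∧ K = I + 1 then (1 - q ^ (I + 1)) / (1 - s * x)
  else if j = 0 ∧ l = 1 ∧ I = K + 1 then x * (1 - s ^ 2 * q ^ K) / (1 - s * x)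
  else 0

/-- Weight `M_{x,s}(I, j; K, l)` of a vertex of type 2, with the same conventions. -/
def weightM (q s x : ℂ) (I : ℕ) (j : Fin 2) (K : ℕ) (l : Fin 2) : ℂ :=
  if j = 0 ∧ l = 0 ∧ K = I then (x - s * q ^ I) / (1 - s * x)
  else if j = 1 ∧ l = 1 ∧ K = I then (1 - s * x * q ^ I) / (1 - s * x)
  else if j = 1 ∧ l = 0 ∧ K = I + 1 then x * (1 - q ^ (I + 1)) / (1 - s * x)
  else if j = 0 ∧ l = 1 ∧ I = K + 1 then (1 - s ^ 2 * q ^ K) / (1 - s * x)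
  else 0

/-- The one-row partition function with vertex weights `w`, on the columns with abscissas
`…, -3, -2, -1`, with bottom boundary `β`, top boundary `τ`, left boundary `a` (at `-∞`) and
right boundary `b`. A configuration is a function `h : ℕ → {0, 1}`: `h i` is the number of paths
on the horizontal edge between the columns `-(i + 1)` and `-i`, so that the vertex in column
`-(i + 1)` has left edge `h (i + 1)` and right edge `h i`; the edge `h 0` is the right boundary,
and `h i = a` for all large `i`. At most one configuration has non-zero weight (the vertices
conserve paths), and all but finitely many vertices of a configuration have weight `1`
in the rows used below. -/
def rowPF (w : ℕ → Fin 2 → ℕ → Fin 2 → ℂ) (a b : Fin 2) (β τ : Ptn) : ℂ :=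
  ∑ᶠ h ∈ {h : ℕ → Fin 2 | h 0 = b ∧ ∀ᶠ i in Filter.atTop, h i = a},
    ∏ᶠ i : ℕ, w (mult β (i + 1)) (h (i + 1)) (mult τ (i + 1)) (h i)

/-- Matrix element `⟨β| T_0(x) + T_1(x) |τ⟩` of the row operator with vertices of type 1,
left boundary `0` and free right boundary. -/
def rowT (q s x : ℂ) (β τ : Ptn) : ℂ :=
  rowPF (weightL q s x) 0 0 β τ + rowPF (weightL q s x) 0 1 β τ

/-- Matrix element `⟨β| T*_0(x) + T*_1(x) |τ⟩` of the row operator with vertices of type 2,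
left boundary `1` and free right boundary. -/
def rowTstar (q s x : ℂ) (β τ : Ptn) : ℂ :=
  rowPF (weightM q s x) 1 0 β τ + rowPF (weightM q s x) 1 1 β τ

open scoped Classical in
/-- Matrix element `⟨β| A_1 A_2 ⋯ A_k |τ⟩` of a product of operators, which are given by their
matrix elements in the basis of partitions. The empty product is the identity. -/
def matProd : List (Ptn → Ptn → ℂ) → Ptn → Ptn → ℂ
  | [], β, τ => if β = τ then 1 else 0
  | A :: l, β, τ => ∑ᶠ κ : Ptn, A β κ * matProd l κ τ

/-- The skew stable spin Hall–Littlewood function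
`f_{μ/ν}(x_1, …, x_m) = ⟨μ| T(x_m) ⋯ T(x_2) T(x_1) |ν⟩`. -/
def skewF (q s : ℂ) (μ ν : Ptn) {m : ℕ} (x : Fin m → ℂ) : ℂ :=
  matProd ((List.ofFn x).reverse.map (rowT q s)) μ ν

/-- The dual skew stable spin Hall–Littlewood function
`g_{μ/ν}(y_1, …, y_n) = ⟨ν| T*(y_1) T*(y_2) ⋯ T*(y_n) |μ⟩`. -/
def skewG (q s : ℂ) (μ ν : Ptn) {n : ℕ} (y : Fin n → ℂ) : ℂ :=
  matProd ((List.ofFn y).map (rowTstar q s)) ν μ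

end

end SSHL

/-! The identity iterates one commutation relation between row operators, `(1 - x y) T*(y) T(x) = (1
- q x y) T(x) T*(y)`: moving all `T*` to the right past all `T` collects one factor per pair.

The relation comes from a Yang–Baxter equation. The cross vertex `crossW` can be pulled through one
column of an `M` row and an `L` row while exchanging the rows (`yang_baxter`). Columns are added one
at a time on the right of the empty states, which gives the exchange for whole rows
(`pairZ_intertwine`). At the far left, where the `M` row carries a path and the `L` row none, the
cross contributes `1 - x y`: its other outcome would have to pass infinitely many empty columns,
each of factor `(x - s)(y - s) / ((1 - s x)(1 - s y))`, of modulus less than one. At the free right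
boundary the outgoing weights of the cross sum to `1 - q x y` (`sum_crossW`).

The rest is analysis. `T` lowers the size of a partition and `T*` raises it, so `T T*` is a finite
sum but `T* T` is an infinite one, and associativity of products has to be justified. An occupied
edge of an `L` row, or an empty edge of an `M` row, costs about one factor `(x - s)/(1 - s x)`, or
`(y - s)/(1 - s y)`. The vectors involved therefore decay geometrically in the size, with boundedly
many parts (`Decay`), and `tsum_mul_app` supplies Fubini. -/

namespace SSHL

noncomputable section

/-! ### States as multisets, built column by column -/

open Multiset in
/-- The multiset with `J` zeros, whose other elements are the successors of those of `κ`. -/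
def dcons (J : ℕ) (κ : Multiset ℕ) : Multiset ℕ := replicate J 0 + κ.map Nat.succ

@[simp] theorem count_zero_dcons (J : ℕ) (κ : Multiset ℕ) : (dcons J κ).count 0 = J := by
  simp [dcons]

@[simp] theorem count_succ_dcons (J : ℕ) (κ : Multiset ℕ) (i : ℕ) :
    (dcons J κ).count (i + 1) = κ.count i := by
  have h : (Multiset.replicate J 0).count (i + 1) = 0 := by
    rw [Multiset.count_replicate]; simp
  rw [dcons, Multiset.count_add, h, zero_add]
  exact Multiset.count_map_eq_count' _ _ Nat.succ_injective i

@[simp] theorem card_dcons (J : ℕ) (κ : Multiset ℕ) : (dcons J κ).card = J + κ.card := by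
  simp [dcons]

/-- The size of the partition whose parts are the successors of the elements of `κ`. -/
def wt (κ : Multiset ℕ) : ℕ := κ.sum + κ.card

@[simp] theorem wt_dcons (J : ℕ) (κ : Multiset ℕ) :
    wt (dcons J κ) = wt κ + κ.card + J := by
  have : (κ.map Nat.succ).sum = κ.sum + κ.card := by
    simp [Nat.succ_eq_add_one, Multiset.sum_map_add]
  simp only [wt, card_dcons]
  simp [dcons, this]
  omega

@[simp] theorem wt_zero : wt 0 = 0 := rfl

theorem dcons_zero_zero : dcons 0 0 = 0 := by simp [dcons]

theorem exists_dcons (s : Multiset ℕ) : ∃ J κ, dcons J κ = s := by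
  refine ⟨s.count 0, (s.filter (· ≠ 0)).map Nat.pred, ?_⟩
  ext i
  cases i with
  | zero => simp
  | succ i =>
    rw [count_succ_dcons, Multiset.count_map, Multiset.filter_filter, Multiset.count,
      Multiset.countP_eq_card_filter]
    congr 1
    refine Multiset.filter_congr fun a _ => ?_
    simp only [Nat.pred_eq_sub_one]
    omega

/-- `dcons` as a bijection. -/
def dconsEquiv : ℕ × Multiset ℕ ≃ Multiset ℕ :=
  Equiv.ofBijective (fun p => dcons p.1 p.2) <| by
    constructor
    · rintro ⟨J, κ⟩ ⟨J', κ'⟩ h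
      replace h : dcons J κ = dcons J' κ' := h
      refine Prod.ext ?_ ?_
      · simpa using congrArg (Multiset.count 0) h
      · ext i
        simpa using congrArg (Multiset.count (i + 1)) h
    · intro s
      obtain ⟨J, κ, h⟩ := exists_dcons s
      exact ⟨(J, κ), h⟩

@[simp] theorem dconsEquiv_apply (p : ℕ × Multiset ℕ) : dconsEquiv p = dcons p.1 p.2 := rfl

/-- Induction on columns: two states occupy finitely many columns in all, so stripping the rightmost
column of both repeatedly ends at two empty states. -/
theorem dcons_pair_induction {P : Multiset ℕ → Multiset ℕ → Prop} (h0 : P 0 0)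
    (hs : ∀ I K β τ, P β τ → P (dcons I β) (dcons K τ)) (β τ : Multiset ℕ) : P β τ := by
  have key : ∀ N : ℕ, ∀ β τ : Multiset ℕ, (∀ i ∈ β, i < N) → (∀ i ∈ τ, i < N) → P β τ := by
    intro N
    induction N with
    | zero =>
      intro β τ hβ hτ
      rw [Multiset.eq_zero_of_forall_notMem fun i hi => absurd (hβ i hi) (by omega),
        Multiset.eq_zero_of_forall_notMem fun i hi => absurd (hτ i hi) (by omega)]
      exact h0
    | succ N ih =>
      intro β τ hβ hτ
      obtain ⟨I, β', rfl⟩ := exists_dcons β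
      obtain ⟨K, τ', rfl⟩ := exists_dcons τ
      refine hs _ _ _ _ (ih _ _ (fun i hi => ?_) (fun i hi => ?_))
      · have := hβ (i + 1) (by simp [dcons, hi])
        omega
      · have := hτ (i + 1) (by simp [dcons, hi])
        omega
  refine key (β.sum + τ.sum + 1) β τ (fun i hi => ?_) (fun i hi => ?_)
  · have := Multiset.single_le_sum (fun _ _ => Nat.zero_le _) i hi
    omega
  · have := Multiset.single_le_sum (fun _ _ => Nat.zero_le _) i hi
    omega

/-! ### One-row partition functions -/

/-- The weights `w` conserve paths, and the horizontal edge `a` continues through an empty column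
with weight `1`. -/
structure Conserving (w : ℕ → Fin 2 → ℕ → Fin 2 → ℂ) (a : Fin 2) : Prop where
  cons : ∀ I c K b, w I c K b ≠ 0 → I + c.val = K + b.val
  one : w 0 a 0 a = 1

/-- The sequences of horizontal edges that end at `b` and begin at `a`. -/
def edges (a b : Fin 2) : Set (ℕ → Fin 2) := {h | h 0 = b ∧ ∀ᶠ i in Filter.atTop, h i = a}

/-- The weight of a row configuration. -/
def confW (w : ℕ → Fin 2 → ℕ → Fin 2 → ℂ) (β τ : Multiset ℕ) (h : ℕ → Fin 2) : ℂ :=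
  ∏ᶠ i : ℕ, w (β.count i) (h (i + 1)) (τ.count i) (h i)

/-- The one-row partition function, with vertical states given by multisets. -/
def rowZ (w : ℕ → Fin 2 → ℕ → Fin 2 → ℂ) (a b : Fin 2) (β τ : Multiset ℕ) : ℂ :=
  ∑ᶠ h ∈ edges a b, confW w β τ h

theorem eventually_count_eq_zero (β : Multiset ℕ) : ∀ᶠ i in Filter.atTop, β.count i = 0 := by
  filter_upwards [Filter.eventually_gt_atTop β.sum] with i hi
  refine Multiset.count_eq_zero.2 fun h => ?_
  have := Multiset.single_le_sum (fun _ _ => Nat.zero_le _) i h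
  omega

section Row

variable {w : ℕ → Fin 2 → ℕ → Fin 2 → ℂ} {a : Fin 2}

theorem exists_trivial_tail (hw : Conserving w a) (β τ : Multiset ℕ) {b : Fin 2}
    {h : ℕ → Fin 2} (hh : h ∈ edges a b) :
    ∃ N, ∀ i ≥ N, w (β.count i) (h (i + 1)) (τ.count i) (h i) = 1 := by
  have h1 := hh.2
  have h2 := (Filter.tendsto_add_atTop_nat 1).eventually hh.2
  have := (((eventually_count_eq_zero β).and (eventually_count_eq_zero τ)).and (h1.and h2))
  obtain ⟨N, hN⟩ := Filter.eventually_atTop.1 this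
  refine ⟨N, fun i hi => ?_⟩
  obtain ⟨⟨e1, e2⟩, e3, e4⟩ := hN i hi
  rw [e1, e2, e3, e4, hw.one]

theorem confW_eq_prod (hw : Conserving w a) (β τ : Multiset ℕ) {b : Fin 2}
    {h : ℕ → Fin 2} (hh : h ∈ edges a b) :
    ∃ N, ∀ n ≥ N, confW w β τ h =
      ∏ i ∈ Finset.range n, w (β.count i) (h (i + 1)) (τ.count i) (h i) := by
  obtain ⟨N, hN⟩ := exists_trivial_tail hw β τ hh
  refine ⟨N, fun n hn => finprod_eq_prod_of_mulSupport_subset _ fun i hi => ?_⟩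
  by_contra hc
  exact hi (hN i (by simp at hc; omega))

theorem cons_of_confW_ne_zero (hw : Conserving w a) {β τ : Multiset ℕ} {b : Fin 2}
    {h : ℕ → Fin 2} (hh : h ∈ edges a b) (hne : confW w β τ h ≠ 0) (i : ℕ) :
    β.count i + (h (i + 1)).val = τ.count i + (h i).val := by
  obtain ⟨N, hN⟩ := confW_eq_prod hw β τ hh
  rw [hN (N + i + 1) (by omega)] at hne
  exact hw.cons _ _ _ _ (Finset.prod_ne_zero_iff.1 hne i (by simp))

/-- Far to the left every edge is `a`, and in each column conservation determines the right edge
from the left one. -/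
theorem confW_support_subsingleton (hw : Conserving w a) (β τ : Multiset ℕ) (b : Fin 2) :
    (edges a b ∩ Function.support (confW w β τ)).Subsingleton := by
  rintro h ⟨hh, hne⟩ h' ⟨hh', hne'⟩
  obtain ⟨N, hN⟩ := Filter.eventually_atTop.1 (hh.2.and hh'.2)
  have key : ∀ k i, N ≤ i + k → h i = h' i := by
    intro k
    induction k with
    | zero => exact fun i hi => (hN i hi).1.trans (hN i hi).2.symm
    | succ k ih =>
      intro i hi
      have e := ih (i + 1) (by omega)
      have e1 := cons_of_confW_ne_zero hw hh hne i
      have e2 := cons_of_confW_ne_zero hw hh' hne' i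
      rw [e] at e1
      exact Fin.ext (by omega)
  exact funext fun i => key N i (by omega)

/-- Prepend an edge to a sequence of edges. -/
def pre (b : Fin 2) (h : ℕ → Fin 2) : ℕ → Fin 2
  | 0 => b
  | i + 1 => h i

theorem pre_injective (b : Fin 2) : Function.Injective (pre b) := fun _ _ e =>
  funext fun i => congrFun e (i + 1)

theorem pre_mem_edges {b c : Fin 2} {h : ℕ → Fin 2} (hh : h ∈ edges a c) :
    pre b h ∈ edges a b := by
  refine ⟨rfl, ?_⟩
  obtain ⟨N, hN⟩ := Filter.eventually_atTop.1 hh.2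
  refine Filter.eventually_atTop.2 ⟨N + 1, fun i hi => ?_⟩
  obtain ⟨j, rfl⟩ : ∃ j, i = j + 1 := ⟨i - 1, by omega⟩
  exact hN j (by omega)

theorem edges_eq (a b : Fin 2) :
    edges a b = pre b '' edges a 0 ∪ pre b '' edges a 1 := by
  ext h
  constructor
  · intro hh
    have e : pre b (fun i => h (i + 1)) = h := by
      funext i
      cases i with
      | zero => exact hh.1.symm
      | succ i => rfl
    have h2 : ∀ᶠ i in Filter.atTop, h (i + 1) = a :=
      (Filter.tendsto_add_atTop_nat 1).eventually hh.2
    have h3 : h 1 = 0 ∨ h 1 = 1 := by omega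
    rcases h3 with h3 | h3
    · exact Or.inl ⟨_, ⟨h3, h2⟩, e⟩
    · exact Or.inr ⟨_, ⟨h3, h2⟩, e⟩
  · rintro (⟨g, hg, rfl⟩ | ⟨g, hg, rfl⟩) <;> exact pre_mem_edges hg

theorem confW_pre (hw : Conserving w a) (I K : ℕ) (β τ : Multiset ℕ) {b c : Fin 2}
    {h : ℕ → Fin 2} (hh : h ∈ edges a c) :
    confW w (dcons I β) (dcons K τ) (pre b h) = confW w β τ h * w I c K b := by
  obtain ⟨N, hN⟩ := confW_eq_prod hw (dcons I β) (dcons K τ) (pre_mem_edges (b := b) hh)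
  obtain ⟨N', hN'⟩ := confW_eq_prod hw β τ hh
  rw [hN (N + N' + 1) (by omega), hN' (N + N') (by omega), Finset.prod_range_succ']
  simp [pre, hh.1]

theorem finsum_image_pre (hw : Conserving w a) (I K : ℕ) (β τ : Multiset ℕ) (b c : Fin 2) :
    ∑ᶠ h ∈ pre b '' edges a c, confW w (dcons I β) (dcons K τ) h =
      rowZ w a c β τ * w I c K b := by
  rw [finsum_mem_image ((pre_injective b).injOn), rowZ, finsum_mem_mul]
  exact finsum_mem_congr rfl fun h hh => confW_pre hw I K β τ hh

/-- The transfer recursion behind every induction on columns: the left edge `c` of the rightmost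
column is the right boundary of the remaining row. -/
theorem rowZ_dcons (hw : Conserving w a) (I K : ℕ) (β τ : Multiset ℕ) (b : Fin 2) :
    rowZ w a b (dcons I β) (dcons K τ) = ∑ c : Fin 2, rowZ w a c β τ * w I c K b := by
  have hsub : ∀ c, (pre b '' edges a c ∩
      Function.support (confW w (dcons I β) (dcons K τ))).Finite := fun c =>
    ((confW_support_subsingleton hw (dcons I β) (dcons K τ) b).finite).subset
      (Set.inter_subset_inter_left _ (by rintro _ ⟨g, hg, rfl⟩; exact pre_mem_edges hg))
  have hdisj : Disjoint (pre b '' edges a 0) (pre b '' edges a 1) := by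
    rw [Set.disjoint_left]
    rintro _ ⟨g, hg, rfl⟩ ⟨g', hg', e⟩
    have := pre_injective b e
    subst this
    have := hg.1.symm.trans hg'.1
    simp at this
  rw [rowZ, edges_eq, finsum_mem_union' hdisj (hsub 0) (hsub 1), finsum_image_pre hw,
    finsum_image_pre hw, Fin.sum_univ_two]

theorem rowZ_zero (hw : Conserving w a) (b : Fin 2) :
    rowZ w a b 0 0 = if b = a then 1 else 0 := by
  have hconst : ∀ h ∈ edges a b, confW w 0 0 h ≠ 0 → h = fun _ => a := by
    intro h hh hne
    have e : ∀ i, h i = h 0 := by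
      intro i
      induction i with
      | zero => rfl
      | succ i ih =>
        have := cons_of_confW_ne_zero hw hh hne i
        rw [← ih]
        exact Fin.ext (by simpa using this)
    obtain ⟨N, hN⟩ := Filter.eventually_atTop.1 hh.2
    funext i
    rw [e i, ← e N, hN N le_rfl]
  split_ifs with hb
  · subst hb
    rw [rowZ, finsum_mem_inter_support_eq _ _ {fun _ => b}]
    · rw [finsum_mem_singleton]
      simp [confW, hw.one]
    · ext h
      constructor
      · rintro ⟨hh, hne⟩
        exact ⟨hconst h hh hne, hne⟩
      · rintro ⟨rfl, hne⟩
        exact ⟨⟨rfl, Filter.Eventually.of_forall fun _ => rfl⟩, hne⟩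
  · refine finsum_mem_eq_zero_of_forall_eq_zero fun h hh => ?_
    by_contra hne
    have := hconst h hh hne
    exact hb (by rw [← hh.1, this])

theorem rowZ_cons (hw : Conserving w a) (β τ : Multiset ℕ) :
    ∀ b : Fin 2, rowZ w a b β τ ≠ 0 → β.card + a.val = τ.card + b.val := by
  refine dcons_pair_induction (P := fun β τ => ∀ b : Fin 2, rowZ w a b β τ ≠ 0 →
    β.card + a.val = τ.card + b.val) ?_ ?_ β τ
  · intro b hb
    rw [rowZ_zero hw] at hb
    simp only [ne_eq, ite_eq_right_iff, one_ne_zero, imp_false, not_not] at hb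
    rw [hb]
  · intro I K β τ ih b hb
    rw [rowZ_dcons hw] at hb
    obtain ⟨c, -, hc⟩ := Finset.exists_ne_zero_of_sum_ne_zero hb
    have h1 := ih c (left_ne_zero_of_mul hc)
    have h2 := hw.cons _ _ _ _ (right_ne_zero_of_mul hc)
    simp only [card_dcons]
    omega

end Row

/-! ### The two kinds of weights, and bounds for a row -/

theorem conserving_weightL {q s x : ℂ} (h : 1 - s * x ≠ 0) : Conserving (weightL q s x) 0 := by
  constructor
  · intro I c K b hne
    unfold weightL at hne
    split_ifs at hne with h1 h2 h3 h4 <;> simp_all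
  · simp [weightL, h]

theorem conserving_weightM {q s x : ℂ} (h : 1 - s * x ≠ 0) : Conserving (weightM q s x) 1 := by
  constructor
  · intro I c K b hne
    unfold weightM at hne
    split_ifs at hne with h1 h2 h3 h4 <;> simp_all
  · simp [weightM, h]

/-- Only occupied columns may cost a constant `D`, and there are at most as many of them as parts of
the two states. The exponent `I + K` makes these costs multiply up to a power bounded in terms of
`L`, however long the row is. -/
theorem exists_weight_bound (w : ℕ → Fin 2 → ℕ → Fin 2 → ℂ) {ρ : Fin 2 → ℝ}
    (hρ : ∀ b, 0 < ρ b) (h0 : ∀ c b, ‖w 0 c 0 b‖ ≤ ρ b) (L : ℕ) :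
    ∃ D : ℝ, 1 ≤ D ∧ ∀ I K, I ≤ L → K ≤ L → ∀ c b, ‖w I c K b‖ ≤ D ^ (I + K) * ρ b := by
  let S := Finset.range (L + 1) ×ˢ Finset.range (L + 1) ×ˢ
    (Finset.univ : Finset (Fin 2)) ×ˢ (Finset.univ : Finset (Fin 2))
  obtain ⟨D, hD⟩ := Finset.exists_le
    (S.image fun p => ‖w p.1 p.2.2.1 p.2.1 p.2.2.2‖ / ρ p.2.2.2)
  refine ⟨max D 1, le_max_right _ _, fun I K hI hK c b => ?_⟩
  rcases Nat.eq_zero_or_pos (I + K) with h | h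
  · obtain ⟨rfl, rfl⟩ : I = 0 ∧ K = 0 := by omega
    simpa using h0 c b
  · have h1 : ‖w I c K b‖ / ρ b ≤ D := hD _ (Finset.mem_image.2 ⟨(I, K, c, b), by
      simp [S]; omega, rfl⟩)
    rw [← div_le_iff₀ (hρ b)]
    calc _ ≤ max D 1 := h1.trans (le_max_left _ _)
      _ ≤ (max D 1) ^ (I + K) := le_self_pow₀ (le_max_right _ _) (by omega)

section Bounds

variable {w : ℕ → Fin 2 → ℕ → Fin 2 → ℂ}

theorem rowZ_dcons_of_ne_zero {a : Fin 2} (hw : Conserving w a) {I K : ℕ} {β τ : Multiset ℕ}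
    {b : Fin 2} (hne : rowZ w a b (dcons I β) (dcons K τ) ≠ 0) :
    ∃ c, rowZ w a b (dcons I β) (dcons K τ) = rowZ w a c β τ * w I c K b ∧
      rowZ w a c β τ ≠ 0 ∧ β.card + a.val = τ.card + c.val ∧ I + c.val = K + b.val := by
  have hne' := hne
  rw [rowZ_dcons hw] at hne'
  obtain ⟨c, -, hc⟩ := Finset.exists_ne_zero_of_sum_ne_zero hne'
  have h1 := rowZ_cons hw β τ c (left_ne_zero_of_mul hc)
  have h2 := hw.cons _ _ _ _ (right_ne_zero_of_mul hc)
  refine ⟨c, ?_, left_ne_zero_of_mul hc, h1, h2⟩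
  rw [rowZ_dcons hw]
  refine Finset.sum_eq_single c (fun d _ hd => ?_) (by simp)
  by_contra hcon
  have h3 := rowZ_cons hw β τ d (left_ne_zero_of_mul hcon)
  exact hd (Fin.ext (by omega))

/-- By conservation, `wt β - wt τ` is the number of occupied horizontal edges. With left boundary
`1`, `wt τ - wt β` is likewise the number of empty ones. -/
theorem wt_le_of_rowZ_ne_zero (hw : Conserving w 0) (β τ : Multiset ℕ) :
    ∀ b, rowZ w 0 b β τ ≠ 0 → wt τ ≤ wt β := by
  refine dcons_pair_induction (P := fun β τ => ∀ b, rowZ w 0 b β τ ≠ 0 → wt τ ≤ wt β)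
    (fun _ _ => le_rfl) (fun I K β τ ih b hb => ?_) β τ
  obtain ⟨c, -, h1, h2, h3⟩ := rowZ_dcons_of_ne_zero hw hb
  have := ih c h1
  simp only [wt_dcons, Fin.val_zero] at *
  omega

theorem wt_le_of_rowZ_ne_zero' (hw : Conserving w 1) (β τ : Multiset ℕ) :
    ∀ b, rowZ w 1 b β τ ≠ 0 → wt β ≤ wt τ := by
  refine dcons_pair_induction (P := fun β τ => ∀ b, rowZ w 1 b β τ ≠ 0 → wt β ≤ wt τ)
    (fun _ _ => le_rfl) (fun I K β τ ih b hb => ?_) β τ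
  obtain ⟨c, -, h1, h2, h3⟩ := rowZ_dcons_of_ne_zero hw hb
  have := ih c h1
  simp only [wt_dcons, Fin.val_one] at *
  omega

/-- The difference of the sizes counts occupied edges, and a column with right edge `b` contributes
`r ^ b` up to the constants of the occupied columns. Powers of `r` stand on both sides to avoid
subtracting sizes. -/
theorem exists_rowZ_bound (hw : Conserving w 0) {r : ℝ} (hr : 0 < r) (h1 : ‖w 0 1 0 1‖ ≤ r)
    (L : ℕ) : ∃ C : ℝ, 0 < C ∧ ∀ β τ : Multiset ℕ, β.card ≤ L → τ.card ≤ L → ∀ b,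
      ‖rowZ w 0 b β τ‖ * r ^ wt τ ≤ C * r ^ wt β := by
  obtain ⟨D, hD1, hD⟩ := exists_weight_bound w (ρ := fun b => r ^ b.val) (fun b => by positivity)
    (fun c b => by
      by_cases h : w 0 c 0 b = 0
      · rw [h, norm_zero]; positivity
      · have := hw.cons _ _ _ _ h
        obtain rfl : c = b := Fin.ext (by omega)
        have h3 : c = 0 ∨ c = 1 := by omega
        rcases h3 with rfl | rfl
        · simp [hw.one]
        · simpa using h1) L
  have hD0 : 0 < D := by linarith
  have key : ∀ β τ : Multiset ℕ, ∀ b, β.card ≤ L → τ.card ≤ L →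
      ‖rowZ w 0 b β τ‖ * r ^ wt τ ≤ D ^ (β.card + τ.card) * r ^ wt β := by
    refine dcons_pair_induction ?_ ?_
    · intro b _ _
      rw [rowZ_zero hw]
      split_ifs <;> simp
    · intro I K β τ ih b hβ hτ
      by_cases hne : rowZ w 0 b (dcons I β) (dcons K τ) = 0
      · rw [hne, norm_zero, zero_mul]; positivity
      obtain ⟨c, e, -, e2, e3⟩ := rowZ_dcons_of_ne_zero hw hne
      rw [card_dcons] at hβ hτ
      have i1 := ih c (by omega) (by omega)
      have i2 := hD I K (by omega) (by omega) c b
      simp only [Fin.val_zero] at e2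
      -- Conservation in the row and in the new column gives `card β + I = card τ + K + b`: the new
      -- column adds `b` to the difference of the sizes.
      rw [e, norm_mul, card_dcons, card_dcons, wt_dcons, wt_dcons,
        show wt β + β.card + I = wt β + b.val + (τ.card + K) by omega]
      calc _ = ‖rowZ w 0 c β τ‖ * r ^ wt τ * ‖w I c K b‖ * r ^ (τ.card + K) := by ring
        _ ≤ D ^ (β.card + τ.card) * r ^ wt β * (D ^ (I + K) * r ^ b.val) * r ^ (τ.card + K) := by
          gcongr
        _ = _ := by ring
  refine ⟨D ^ (L + L), by positivity, fun β τ hβ hτ b => (key β τ b hβ hτ).trans ?_⟩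
  gcongr

theorem exists_rowZ_bound' (hw : Conserving w 1) {r : ℝ} (hr : 0 < r) (h1 : ‖w 0 0 0 0‖ ≤ r)
    (L : ℕ) : ∃ C : ℝ, 0 < C ∧ ∀ β τ : Multiset ℕ, β.card ≤ L → τ.card ≤ L → ∀ b,
      ‖rowZ w 1 b β τ‖ * r ^ wt β ≤ C * r ^ wt τ := by
  obtain ⟨D, hD1, hD⟩ := exists_weight_bound w (ρ := fun b => r ^ (1 - b.val))
    (fun b => by positivity)
    (fun c b => by
      by_cases h : w 0 c 0 b = 0
      · rw [h, norm_zero]; positivity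
      · have := hw.cons _ _ _ _ h
        obtain rfl : c = b := Fin.ext (by omega)
        have h3 : c = 0 ∨ c = 1 := by omega
        rcases h3 with rfl | rfl
        · simpa using h1
        · simp [hw.one]) L
  have hD0 : 0 < D := by linarith
  have key : ∀ β τ : Multiset ℕ, ∀ b, β.card ≤ L → τ.card ≤ L →
      ‖rowZ w 1 b β τ‖ * r ^ wt β ≤ D ^ (β.card + τ.card) * r ^ wt τ := by
    refine dcons_pair_induction ?_ ?_
    · intro b _ _
      rw [rowZ_zero hw]
      split_ifs <;> simp
    · intro I K β τ ih b hβ hτ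
      by_cases hne : rowZ w 1 b (dcons I β) (dcons K τ) = 0
      · rw [hne, norm_zero, zero_mul]; positivity
      obtain ⟨c, e, -, e2, e3⟩ := rowZ_dcons_of_ne_zero hw hne
      rw [card_dcons] at hβ hτ
      have i1 := ih c (by omega) (by omega)
      have i2 := hD I K (by omega) (by omega) c b
      simp only [Fin.val_one] at e2
      rw [e, norm_mul, card_dcons, card_dcons, wt_dcons, wt_dcons,
        show wt τ + τ.card + K = wt τ + (1 - b.val) + (β.card + I) by omega]
      calc _ = ‖rowZ w 1 c β τ‖ * r ^ wt β * ‖w I c K b‖ * r ^ (β.card + I) := by ring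
        _ ≤ D ^ (β.card + τ.card) * r ^ wt τ * (D ^ (I + K) * r ^ (1 - b.val)) *
            r ^ (β.card + I) := by
          gcongr
        _ = _ := by ring
  refine ⟨D ^ (L + L), by positivity, fun β τ hβ hτ b => (key β τ b hβ hτ).trans ?_⟩
  gcongr

end Bounds

/-! ### Summability over states with boundedly many parts -/

/-- Multisets with a fixed number of elements are summable with geometric weights. -/
theorem summable_pow_sum_card_eq {ρ : ℝ} (h0 : 0 ≤ ρ) (h1 : ρ < 1) (L : ℕ) :
    Summable fun κ : {κ : Multiset ℕ // κ.card = L} => ρ ^ κ.1.sum := by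
  induction L with
  | zero =>
    have : Finite {κ : Multiset ℕ // κ.card = 0} := by
      refine Set.Finite.to_subtype (s := {κ : Multiset ℕ | κ.card = 0})
        ((Set.finite_singleton (0 : Multiset ℕ)).subset ?_)
      intro κ hκ
      simpa using hκ
    exact Summable.of_finite
  | succ L ih =>
    -- Removing one chosen element is injective into pairs, so the sum is dominated by a geometric
    -- series times the sum for `L`.
    have hex : ∀ κ : {κ : Multiset ℕ // κ.card = L + 1}, ∃ p : ℕ × {κ : Multiset ℕ // κ.card = L},
        κ.1 = p.1 ::ₘ p.2.1 := by
      rintro ⟨κ, hκ⟩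
      obtain ⟨i, hi⟩ := Multiset.card_pos_iff_exists_mem.1 (by omega : 0 < κ.card)
      obtain ⟨t, rfl⟩ := Multiset.exists_cons_of_mem hi
      exact ⟨(_, ⟨t, by simpa using hκ⟩), rfl⟩
    choose p hp using hex
    have hinj : Function.Injective p := fun κ κ' e => Subtype.ext (by rw [hp, hp κ', e])
    have := ((summable_geometric_of_lt_one h0 h1).mul_of_nonneg ih (fun _ => by positivity)
      (fun _ => by positivity)).comp_injective hinj
    refine this.congr fun κ => ?_
    simp [hp κ, pow_add]

/-- Raising all elements by one and padding with zeros to exactly `L` elements turns `wt` into the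
sum and loses nothing. -/
theorem summable_pow_wt {ρ : ℝ} (h0 : 0 ≤ ρ) (h1 : ρ < 1) (L : ℕ) :
    Summable fun κ : {κ : Multiset ℕ // κ.card ≤ L} => ρ ^ wt κ.1 := by
  let p : {κ : Multiset ℕ // κ.card ≤ L} → {κ : Multiset ℕ // κ.card = L} := fun κ =>
    ⟨κ.1.map Nat.succ + Multiset.replicate (L - κ.1.card) 0, by
      have := κ.2
      simp; omega⟩
  have hinj : Function.Injective p := by
    rintro ⟨κ, hκ⟩ ⟨κ', hκ'⟩ e
    have e' := congrArg Subtype.val e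
    refine Subtype.ext ?_
    ext i
    have := congrArg (Multiset.count (i + 1)) e'
    have hz : ∀ n, (Multiset.replicate n 0).count (i + 1) = 0 := fun n => by
      rw [Multiset.count_replicate]; simp
    have hm : ∀ t : Multiset ℕ, (t.map Nat.succ).count (i + 1) = t.count i := fun t =>
      Multiset.count_map_eq_count' _ _ Nat.succ_injective i
    simpa only [p, Multiset.count_add, hz, hm, add_zero] using this
  refine ((summable_pow_sum_card_eq h0 h1 L).comp_injective hinj).congr fun κ => ?_
  simp [p, wt, Nat.succ_eq_add_one, Multiset.sum_map_add]

/-! ### The Yang–Baxter equation for one column -/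

section Columns

variable {w : ℕ → Fin 2 → ℕ → Fin 2 → ℂ} {a : Fin 2}

/-- The column with two vertices, `w₁` below and `w₂` above, summed over the edge between them. -/
def column (w₁ w₂ : ℕ → Fin 2 → ℕ → Fin 2 → ℂ) (I K : ℕ) (a₁ a₂ b₁ b₂ : Fin 2) : ℂ :=
  ∑' J, w₁ I a₁ J b₁ * w₂ J a₂ K b₂

theorem Conserving.eq_zero (hw : Conserving w a) {I K : ℕ} {c b : Fin 2}
    (h : I + c.val ≠ K + b.val) : w I c K b = 0 := by
  by_contra hne
  exact h (hw.cons _ _ _ _ hne)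

theorem Conserving.hasSum_single (hw : Conserving w a) {I J : ℕ} {c b : Fin 2}
    (h : I + c.val = J + b.val) (F : ℕ → ℂ) :
    HasSum (fun J => w I c J b * F J) (w I c J b * F J) := by
  refine _root_.hasSum_single J fun J' hJ' => ?_
  rw [hw.eq_zero (by omega), zero_mul]

theorem Conserving.hasSum_zero (hw : Conserving w a) {F : ℕ → ℂ} :
    HasSum (fun J => w 0 0 J 1 * F J) 0 := by
  convert _root_.hasSum_zero using 2 with J
  rw [hw.eq_zero (by simp), zero_mul]

theorem Conserving.summable_norm (hw : Conserving w a) (I : ℕ) (c b : Fin 2) (F : ℕ → ℂ) :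
    Summable fun J => ‖w I c J b * F J‖ := by
  refine summable_of_hasFiniteSupport ((Set.finite_Iic (I + 1)).subset fun J hJ => ?_)
  have := hw.cons I c J b fun h => hJ (by simp [h])
  simp only [Set.mem_Iic]
  omega

/-- The vertex weights that intertwine a column with `M` below and `L` above and a column with
`L` below and `M` above. The horizontal edges of the `M` row come first. -/
def crossW (q x y : ℂ) (a b c d : Fin 2) : ℂ :=
  if a = b then (if c = a ∧ d = a then 1 - q * x * y else 0)
  else if c = d then 0
  else if a = 1 then (if c = 1 then 1 - x * y else x * y * (1 - q))
  else (if c = 1 then 1 - q else q * (1 - x * y))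

theorem crossW_cons {q x y : ℂ} {a b c d : Fin 2} (h : crossW q x y a b c d ≠ 0) :
    a.val + b.val = c.val + d.val := by
  unfold crossW at h
  split_ifs at h <;> simp_all <;> omega

theorem Conserving.column_cons {w' : ℕ → Fin 2 → ℕ → Fin 2 → ℂ} {a' : Fin 2}
    (hw : Conserving w a) (hw' : Conserving w' a') {I K : ℕ} {a₁ a₂ b₁ b₂ : Fin 2}
    (h : column w w' I K a₁ a₂ b₁ b₂ ≠ 0) :
    I + a₁.val + a₂.val = K + b₁.val + b₂.val := by
  by_contra hne
  refine h ((tsum_congr fun J => ?_).trans tsum_zero)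
  by_contra hJ
  have h1 := hw.cons _ _ _ _ (left_ne_zero_of_mul hJ)
  have h2 := hw'.cons _ _ _ _ (right_ne_zero_of_mul hJ)
  omega

-- Conservation leaves at most one middle state `J` in each column sum, so every case is a rational
-- identity in `q`, `s`, `x`, `y` and a power of `q`.
set_option linter.unusedSimpArgs false in
theorem yang_baxter {q s x y : ℂ} (hx : 1 - s * x ≠ 0) (hy : 1 - s * y ≠ 0) (I K : ℕ)
    (a b a' b' : Fin 2) :
    ∑ c, ∑ d, crossW q x y a b c d * column (weightM q s y) (weightL q s x) I K c d a' b' =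
      ∑ c, ∑ d, column (weightL q s x) (weightM q s y) I K b a d c * crossW q x y c d a' b' := by
  have l00 : ∀ (I : ℕ) (F : ℕ → ℂ), ∑' J, weightL q s x I 0 J 0 * F J =
      weightL q s x I 0 I 0 * F I := fun I F =>
    ((conserving_weightL hx).hasSum_single (J := I) (c := 0) (b := 0) rfl F).tsum_eq
  have l11 : ∀ (I : ℕ) (F : ℕ → ℂ), ∑' J, weightL q s x I 1 J 1 * F J =
      weightL q s x I 1 I 1 * F I := fun I F =>
    ((conserving_weightL hx).hasSum_single (J := I) (c := 1) (b := 1) rfl F).tsum_eq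
  have l10 : ∀ (I : ℕ) (F : ℕ → ℂ), ∑' J, weightL q s x I 1 J 0 * F J =
      weightL q s x I 1 (I + 1) 0 * F (I + 1) := fun I F =>
    ((conserving_weightL hx).hasSum_single (J := I + 1) (c := 1) (b := 0) rfl F).tsum_eq
  have l01 : ∀ (I : ℕ) (F : ℕ → ℂ), ∑' J, weightL q s x (I + 1) 0 J 1 * F J =
      weightL q s x (I + 1) 0 I 1 * F I := fun I F =>
    ((conserving_weightL hx).hasSum_single (J := I) (c := 0) (b := 1) rfl F).tsum_eq
  have l01' : ∀ F : ℕ → ℂ, ∑' J, weightL q s x 0 0 J 1 * F J = 0 := fun F =>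
    ((conserving_weightL hx).hasSum_zero).tsum_eq
  have m00 : ∀ (I : ℕ) (F : ℕ → ℂ), ∑' J, weightM q s y I 0 J 0 * F J =
      weightM q s y I 0 I 0 * F I := fun I F =>
    ((conserving_weightM hy).hasSum_single (J := I) (c := 0) (b := 0) rfl F).tsum_eq
  have m11 : ∀ (I : ℕ) (F : ℕ → ℂ), ∑' J, weightM q s y I 1 J 1 * F J =
      weightM q s y I 1 I 1 * F I := fun I F =>
    ((conserving_weightM hy).hasSum_single (J := I) (c := 1) (b := 1) rfl F).tsum_eq
  have m10 : ∀ (I : ℕ) (F : ℕ → ℂ), ∑' J, weightM q s y I 1 J 0 * F J =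
      weightM q s y I 1 (I + 1) 0 * F (I + 1) := fun I F =>
    ((conserving_weightM hy).hasSum_single (J := I + 1) (c := 1) (b := 0) rfl F).tsum_eq
  have m01 : ∀ (I : ℕ) (F : ℕ → ℂ), ∑' J, weightM q s y (I + 1) 0 J 1 * F J =
      weightM q s y (I + 1) 0 I 1 * F I := fun I F =>
    ((conserving_weightM hy).hasSum_single (J := I) (c := 0) (b := 1) rfl F).tsum_eq
  have m01' : ∀ F : ℕ → ℂ, ∑' J, weightM q s y 0 0 J 1 * F J = 0 := fun F =>
    ((conserving_weightM hy).hasSum_zero).tsum_eq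
  have ha : a = 0 ∨ a = 1 := by omega
  have hb : b = 0 ∨ b = 1 := by omega
  have ha' : a' = 0 ∨ a' = 1 := by omega
  have hb' : b' = 0 ∨ b' = 1 := by omega
  by_cases hcons : I + a.val + b.val = K + a'.val + b'.val
  · have hK : (K = I ∨ K = I + 1 ∨ K = I + 1 + 1) ∨ (I = K + 1 ∨ I = K + 1 + 1) := by omega
    simp only [column, Fin.sum_univ_two]
    rcases hK with (rfl | rfl | rfl) | (rfl | rfl) <;>
      rcases ha with rfl | rfl <;> rcases hb with rfl | rfl <;> rcases ha' with rfl | rfl <;>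
      rcases hb' with rfl | rfl <;> simp only [Fin.val_zero, Fin.val_one] at hcons <;>
      first
      | (exfalso; omega)
      | (simp [crossW, l00, l11, l10, l01, m00, m11, m10, m01, weightL, weightM]; done)
      | (simp [crossW, l00, l11, l10, l01, m00, m11, m10, m01, weightL, weightM]; ring1)
      -- The middle state may be `K - 1`, which does not exist for `K = 0`; the corresponding term
      -- is then zero.
      | (rcases K with _ | K <;>
          simp [crossW, l00, l11, l10, l01, l01', m00, m11, m10, m01, m01', weightL,
            weightM] <;> ring1)
  · rw [Finset.sum_eq_zero, Finset.sum_eq_zero]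
    · refine fun c _ => Finset.sum_eq_zero fun d _ => ?_
      by_contra hne
      have h1 := (conserving_weightL hx).column_cons (conserving_weightM hy)
        (left_ne_zero_of_mul hne)
      have h2 := crossW_cons (right_ne_zero_of_mul hne)
      omega
    · refine fun c _ => Finset.sum_eq_zero fun d _ => ?_
      by_contra hne
      have h1 := (conserving_weightM hy).column_cons (conserving_weightL hx)
        (right_ne_zero_of_mul hne)
      have h2 := crossW_cons (left_ne_zero_of_mul hne)
      omega

end Columns

/-! ### Translation between partitions and multisets -/

theorem Ptn.ext_parts {κ κ' : Ptn} (h : κ.2.parts = κ'.2.parts) : κ = κ' := by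
  obtain ⟨n, p⟩ := κ
  obtain ⟨n', p'⟩ := κ'
  obtain rfl : n = n' := by
    rw [← p.parts_sum, ← p'.parts_sum]
    exact congrArg _ h
  exact congrArg _ (Nat.Partition.ext h)

/-- Partitions as multisets of natural numbers: the parts are decreased by one. -/
def ptnEquiv : Ptn ≃ Multiset ℕ :=
  Equiv.ofBijective (fun κ => κ.2.parts.map Nat.pred) <| by
    have hκ : ∀ κ : Ptn, (κ.2.parts.map Nat.pred).map Nat.succ = κ.2.parts := by
      intro κ
      rw [Multiset.map_map]
      conv_rhs => rw [← Multiset.map_id κ.2.parts]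
      exact Multiset.map_congr rfl fun i hi => Nat.succ_pred (κ.2.parts_pos hi).ne'
    constructor
    · intro κ κ' h
      refine Ptn.ext_parts ?_
      rw [← hκ κ, ← hκ κ']
      exact congrArg _ h
    · intro t
      refine ⟨⟨(t.map Nat.succ).sum, ⟨t.map Nat.succ, ?_, rfl⟩⟩, ?_⟩
      · intro i hi
        obtain ⟨j, -, rfl⟩ := Multiset.mem_map.1 hi
        exact Nat.succ_pos j
      · simp

theorem map_succ_ptnEquiv (κ : Ptn) : (ptnEquiv κ).map Nat.succ = κ.2.parts := by
  refine (Multiset.map_map Nat.succ Nat.pred κ.2.parts).trans ?_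
  conv_rhs => rw [← Multiset.map_id κ.2.parts]
  exact Multiset.map_congr rfl fun i hi => Nat.succ_pred (κ.2.parts_pos hi).ne'

theorem count_ptnEquiv (κ : Ptn) (i : ℕ) : (ptnEquiv κ).count i = mult κ (i + 1) := by
  rw [mult, ← map_succ_ptnEquiv]
  exact (Multiset.count_map_eq_count' _ _ Nat.succ_injective i).symm

/-- The number of parts of a partition. -/
def len (κ : Ptn) : ℕ := κ.2.parts.card

@[simp] theorem card_ptnEquiv (κ : Ptn) : (ptnEquiv κ).card = len κ := by
  rw [len, ← map_succ_ptnEquiv, Multiset.card_map]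

@[simp] theorem wt_ptnEquiv (κ : Ptn) : wt (ptnEquiv κ) = κ.1 := by
  have h : ((ptnEquiv κ).map Nat.succ).sum = κ.1 := by rw [map_succ_ptnEquiv, κ.2.parts_sum]
  simpa [wt, Nat.succ_eq_add_one, Multiset.sum_map_add] using h

theorem rowPF_eq (w : ℕ → Fin 2 → ℕ → Fin 2 → ℂ) (a b : Fin 2) (β τ : Ptn) :
    rowPF w a b β τ = rowZ w a b (ptnEquiv β) (ptnEquiv τ) := by
  simp only [rowZ, confW, count_ptnEquiv]
  rfl

theorem finite_size_le (N : ℕ) : {κ : Ptn | κ.1 ≤ N}.Finite := by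
  refine ((Finset.range (N + 1)).sigma fun _ => Finset.univ).finite_toSet.subset fun κ hκ => ?_
  simpa [Nat.lt_succ_iff] using hκ

theorem finite_wt_le (N : ℕ) : {κ : Multiset ℕ | wt κ ≤ N}.Finite := by
  refine ((finite_size_le N).image ptnEquiv).subset fun κ hκ => ?_
  exact ⟨ptnEquiv.symm κ, by simpa [← wt_ptnEquiv] using hκ, by simp⟩

theorem summable_pow_wt_indicator {ρ : ℝ} (h0 : 0 ≤ ρ) (h1 : ρ < 1) (L : ℕ) :
    Summable ({κ : Multiset ℕ | κ.card ≤ L}.indicator fun κ => ρ ^ wt κ) := by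
  rw [← summable_subtype_iff_indicator]
  exact summable_pow_wt h0 h1 L

theorem summable_pow_size {ρ : ℝ} (h0 : 0 ≤ ρ) (h1 : ρ < 1) (L : ℕ) :
    Summable ({κ : Ptn | len κ ≤ L}.indicator fun κ => ρ ^ κ.1) := by
  refine (ptnEquiv.summable_iff.2 (summable_pow_wt_indicator h0 h1 L)).congr fun κ => ?_
  simp [Set.indicator_apply]

/-! ### Two-row partition functions -/

/-- The two-row partition function, summed over the state between the rows. -/
def pairZ (w₁ w₂ : ℕ → Fin 2 → ℕ → Fin 2 → ℂ) (a₁ a₂ b₁ b₂ : Fin 2) (β τ : Multiset ℕ) : ℂ :=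
  ∑' κ, rowZ w₁ a₁ b₁ β κ * rowZ w₂ a₂ b₂ κ τ

section Pairs

variable {w₁ w₂ : ℕ → Fin 2 → ℕ → Fin 2 → ℂ} {a₁ a₂ : Fin 2}

/-- The middle state splits into its rightmost multiplicity `J` and the rest; absolute convergence
turns the double sum into a product of sums. -/
theorem pairZ_dcons (h₁ : Conserving w₁ a₁) (h₂ : Conserving w₂ a₂) (I K : ℕ)
    {β τ : Multiset ℕ}
    (hs : ∀ c d, Summable fun κ => ‖rowZ w₁ a₁ c β κ * rowZ w₂ a₂ d κ τ‖) (b₁ b₂ : Fin 2) :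
    pairZ w₁ w₂ a₁ a₂ b₁ b₂ (dcons I β) (dcons K τ) =
      ∑ c, ∑ d, pairZ w₁ w₂ a₁ a₂ c d β τ * column w₁ w₂ I K c d b₁ b₂ := by
  have hcd : ∀ c d, HasSum (fun p : ℕ × Multiset ℕ => (w₁ I c p.1 b₁ * w₂ p.1 d K b₂) *
      (rowZ w₁ a₁ c β p.2 * rowZ w₂ a₂ d p.2 τ))
      (pairZ w₁ w₂ a₁ a₂ c d β τ * column w₁ w₂ I K c d b₁ b₂) := by
    intro c d
    have e1 := h₁.summable_norm I c b₁ (fun J => w₂ J d K b₂)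
    rw [mul_comm, pairZ, column, tsum_mul_tsum_of_summable_norm e1 (hs c d)]
    exact (summable_mul_of_summable_norm e1 (hs c d)).hasSum
  rw [pairZ, ← dconsEquiv.tsum_eq]
  refine HasSum.tsum_eq ?_
  convert hasSum_sum fun c (_ : c ∈ Finset.univ) =>
    hasSum_sum fun d (_ : d ∈ Finset.univ) => hcd c d using 1
  funext p
  simp only [dconsEquiv_apply, rowZ_dcons h₁, rowZ_dcons h₂, Fin.sum_univ_two]
  ring

theorem summable_lower_raise {w : ℕ → Fin 2 → ℕ → Fin 2 → ℂ} (h : Conserving w 0)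
    (F : Multiset ℕ → ℂ) (b : Fin 2) (β : Multiset ℕ) :
    Summable fun κ => ‖rowZ w 0 b β κ * F κ‖ := by
  refine summable_of_hasFiniteSupport ((finite_wt_le (wt β)).subset fun κ hκ => ?_)
  exact wt_le_of_rowZ_ne_zero h β κ b fun h0 => hκ (by simp [h0])

theorem exists_radii {u v : ℝ} (h : u * v < 1) :
    ∃ r r' : ℝ, u < r ∧ v < r' ∧ r * r' < 1 := by
  have hc : Filter.Tendsto (fun ε : ℝ => (u + ε) * (v + ε)) (nhdsWithin 0 (Set.Ioi 0))
      (nhds (u * v)) := by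
    have : ContinuousAt (fun ε : ℝ => (u + ε) * (v + ε)) 0 := by fun_prop
    simpa [ContinuousAt] using this.tendsto.mono_left nhdsWithin_le_nhds
  obtain ⟨ε, h1, h2⟩ := ((hc.eventually_lt_const h).and self_mem_nhdsWithin).exists
  have : 0 < ε := h2
  exact ⟨u + ε, v + ε, by linarith, by linarith, h1⟩

/-- The infinite middle sum converges here: the middle state has boundedly many parts, and its two
factors are bounded by powers of `r'` and `r` with `r * r' < 1`. -/
theorem summable_raise_lower (h₁ : Conserving w₁ 1) (h₂ : Conserving w₂ 0)
    (h : ‖w₂ 0 1 0 1‖ * ‖w₁ 0 0 0 0‖ < 1) (b₁ b₂ : Fin 2) (β τ : Multiset ℕ) :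
    Summable fun κ => ‖rowZ w₁ 1 b₁ β κ * rowZ w₂ 0 b₂ κ τ‖ := by
  obtain ⟨r, r', hr, hr', hrr⟩ := exists_radii h
  have r0 : 0 < r := (norm_nonneg _).trans_lt hr
  have r0' : 0 < r' := (norm_nonneg _).trans_lt hr'
  let L := β.card + τ.card + 1
  obtain ⟨C, hC, hCb⟩ := exists_rowZ_bound h₂ r0 hr.le L
  obtain ⟨C', hC', hCb'⟩ := exists_rowZ_bound' h₁ r0' hr'.le L
  have hs := summable_pow_wt_indicator (mul_nonneg r0.le r0'.le) hrr L
  refine Summable.of_nonneg_of_le (fun _ => norm_nonneg _) (fun κ => ?_)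
    (hs.mul_left (C / r ^ wt τ * (C' / r' ^ wt β)))
  by_cases hne : rowZ w₁ 1 b₁ β κ = 0
  · rw [hne, zero_mul, norm_zero]
    exact mul_nonneg (by positivity) (Set.indicator_nonneg (fun _ _ => by positivity) _)
  · have hcard := rowZ_cons h₁ _ _ _ hne
    simp only [Fin.val_one] at hcard
    have hκ : κ.card ≤ L := by omega
    have i1 := hCb κ τ hκ (by omega) b₂
    have i2 := hCb' β κ (by omega) hκ b₁
    rw [← le_div_iff₀ (by positivity)] at i1 i2
    rw [Set.indicator_of_mem (show κ ∈ {κ : Multiset ℕ | κ.card ≤ L} from hκ), norm_mul]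
    calc _ ≤ C' * r' ^ wt κ / r' ^ wt β * (C * r ^ wt κ / r ^ wt τ) := by gcongr
      _ = _ := by rw [mul_pow]; ring

end Pairs

/-! ### Commutation of the two row operators -/

section Commutation

variable {q s x y : ℂ}

theorem norm_weight_mul_lt_one (hx : 1 - s * x ≠ 0) (hy : 1 - s * y ≠ 0)
    (h : ‖(x - s) * (y - s)‖ < ‖(1 - s * x) * (1 - s * y)‖) :
    ‖weightL q s x 0 1 0 1‖ * ‖weightM q s y 0 0 0 0‖ < 1 := by
  have e : weightL q s x 0 1 0 1 * weightM q s y 0 0 0 0 =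
      (x - s) * (y - s) / ((1 - s * x) * (1 - s * y)) := by
    simp [weightL, weightM, div_mul_div_comm]
  rw [← norm_mul, e, norm_div, div_lt_one (norm_pos_iff.2 (mul_ne_zero hx hy))]
  exact h

/-- The base case, the cross at the far left. An infinite product is avoided: prepending an empty
column to empty states changes nothing, so the value for `(0, 1)` solves a linear fixed-point
equation. -/
theorem pairZ_weightM_weightL_zero (hx : 1 - s * x ≠ 0) (hy : 1 - s * y ≠ 0)
    (h : ‖(x - s) * (y - s)‖ < ‖(1 - s * x) * (1 - s * y)‖) (a b : Fin 2) :
    (1 - x * y) * pairZ (weightM q s y) (weightL q s x) 1 0 a b 0 0 = crossW q x y 1 0 a b := by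
  have hL := conserving_weightL (q := q) hx
  have hM := conserving_weightM (q := q) hy
  have hz : ∀ a b : Fin 2, a.val + b.val ≠ 1 →
      pairZ (weightM q s y) (weightL q s x) 1 0 a b 0 0 = 0 := by
    refine fun a b hab => (tsum_congr fun κ => ?_).trans tsum_zero
    by_contra hne
    have h1 := rowZ_cons hM _ _ _ (left_ne_zero_of_mul hne)
    have h2 := rowZ_cons hL _ _ _ (right_ne_zero_of_mul hne)
    simp only [Fin.val_one, Fin.val_zero, Multiset.card_zero] at h1 h2
    omega
  have h10 : pairZ (weightM q s y) (weightL q s x) 1 0 1 0 0 0 = 1 := by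
    refine (tsum_eq_single 0 fun κ hκ => ?_).trans (by simp [rowZ_zero hM, rowZ_zero hL])
    by_contra hne
    have h2 := rowZ_cons hL _ _ _ (right_ne_zero_of_mul hne)
    simp only [Fin.val_zero, Multiset.card_zero] at h2
    exact hκ (Multiset.card_eq_zero.1 (by omega))
  have h01 := pairZ_dcons hM hL 0 0 (β := 0) (τ := 0) (fun c d =>
    summable_raise_lower hM hL (norm_weight_mul_lt_one hx hy h) c d 0 0) 0 1
  have c10 : column (weightM q s y) (weightL q s x) 0 0 1 0 0 1 =
      y * (1 - q) * (x * (1 - s ^ 2)) / ((1 - s * x) * (1 - s * y)) := by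
    refine (hM.hasSum_single (J := 1) (by simp) _).tsum_eq.trans ?_
    simp [weightL, weightM, div_mul_div_comm, mul_comm]
  have c01 : column (weightM q s y) (weightL q s x) 0 0 0 1 0 1 =
      (x - s) * (y - s) / ((1 - s * x) * (1 - s * y)) := by
    refine (hM.hasSum_single (J := 0) rfl _).tsum_eq.trans ?_
    simp [weightL, weightM, div_mul_div_comm, mul_comm]
  rw [dcons_zero_zero] at h01
  simp only [Fin.sum_univ_two, hz 0 0 (by simp), hz 1 1 (by simp), h10, c10, c01, zero_mul,
    zero_add, add_zero, one_mul] at h01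
  -- Since `(1 - s x)(1 - s y) - (x - s)(y - s) = (1 - s²)(1 - x y)`, the strict inequality excludes
  -- `s² = 1`. The same identity simplifies the fixed-point equation below.
  have hs : 1 - s ^ 2 ≠ 0 := by
    intro hs
    refine h.ne (congrArg _ ?_)
    linear_combination (1 - x * y) * (-hs)
  have h01' : (1 - x * y) * pairZ (weightM q s y) (weightL q s x) 1 0 0 1 0 0 =
      x * y * (1 - q) := by
    have hx' : 1 - x * s ≠ 0 := mul_comm s x ▸ hx
    have hy' : 1 - y * s ≠ 0 := mul_comm s y ▸ hy
    field_simp at h01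
    refine mul_left_cancel₀ hs ?_
    linear_combination h01
  have ha : a = 0 ∨ a = 1 := by omega
  have hb : b = 0 ∨ b = 1 := by omega
  rcases ha with rfl | rfl <;> rcases hb with rfl | rfl
  · simp [hz 0 0 (by simp), crossW]
  · simp [h01', crossW]
  · simp [h10, crossW]
  · simp [hz 1 1 (by simp), crossW]

theorem pairZ_weightL_weightM_zero (hx : 1 - s * x ≠ 0) (hy : 1 - s * y ≠ 0) (a b : Fin 2) :
    pairZ (weightL q s x) (weightM q s y) 0 1 b a 0 0 = if a = 1 ∧ b = 0 then 1 else 0 := by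
  have hL := conserving_weightL (q := q) hx
  have hM := conserving_weightM (q := q) hy
  refine (tsum_eq_single 0 fun κ hκ => ?_).trans ?_
  · by_contra hne
    have := wt_le_of_rowZ_ne_zero hL _ _ _ (left_ne_zero_of_mul hne)
    simp only [wt, Multiset.sum_zero, Multiset.card_zero] at this
    exact hκ (Multiset.card_eq_zero.1 (by omega))
  · rw [rowZ_zero hL, rowZ_zero hM]
    split_ifs <;> simp_all

/-- The cross, already moved through the columns on the left, passes one more column by
`yang_baxter`. -/
theorem pairZ_intertwine (hx : 1 - s * x ≠ 0) (hy : 1 - s * y ≠ 0)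
    (h : ‖(x - s) * (y - s)‖ < ‖(1 - s * x) * (1 - s * y)‖) (β τ : Multiset ℕ) :
    ∀ a b, (1 - x * y) * pairZ (weightM q s y) (weightL q s x) 1 0 a b β τ =
      ∑ c, ∑ d, pairZ (weightL q s x) (weightM q s y) 0 1 d c β τ * crossW q x y c d a b := by
  refine dcons_pair_induction (P := fun β τ => ∀ a b,
    (1 - x * y) * pairZ (weightM q s y) (weightL q s x) 1 0 a b β τ =
      ∑ c, ∑ d, pairZ (weightL q s x) (weightM q s y) 0 1 d c β τ * crossW q x y c d a b)
    ?_ ?_ β τ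
  · intro a b
    rw [pairZ_weightM_weightL_zero hx hy h]
    simp [pairZ_weightL_weightM_zero hx hy, Fin.sum_univ_two]
  · intro I K β τ ih a b
    have yb := fun c d => yang_baxter (q := q) hx hy I K c d a b
    have hL := conserving_weightL (q := q) hx
    have hM := conserving_weightM (q := q) hy
    have s1 : ∀ c d, Summable fun κ =>
        ‖rowZ (weightM q s y) 1 c β κ * rowZ (weightL q s x) 0 d κ τ‖ := fun c d =>
      summable_raise_lower hM hL (norm_weight_mul_lt_one hx hy h) c d β τ
    have s2 : ∀ c d, Summable fun κ =>
        ‖rowZ (weightL q s x) 0 c β κ * rowZ (weightM q s y) 1 d κ τ‖ := fun c d =>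
      summable_lower_raise hL _ c β
    simp only [pairZ_dcons hM hL I K s1, pairZ_dcons hL hM I K s2]
    simp only [Fin.sum_univ_two] at yb ih ⊢
    generalize column (weightM q s y) (weightL q s x) I K = A at *
    generalize column (weightL q s x) (weightM q s y) I K = B at *
    generalize crossW q x y = R at *
    linear_combination A 0 0 a b * ih 0 0 + A 0 1 a b * ih 0 1 + A 1 0 a b * ih 1 0 +
      A 1 1 a b * ih 1 1 +
      pairZ (weightL q s x) (weightM q s y) 0 1 0 0 β τ * yb 0 0 +
      pairZ (weightL q s x) (weightM q s y) 0 1 1 0 β τ * yb 0 1 +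
      pairZ (weightL q s x) (weightM q s y) 0 1 0 1 β τ * yb 1 0 +
      pairZ (weightL q s x) (weightM q s y) 0 1 1 1 β τ * yb 1 1

theorem sum_crossW (q x y : ℂ) (c d : Fin 2) :
    ∑ a, ∑ b, crossW q x y c d a b = 1 - q * x * y := by
  have hc : c = 0 ∨ c = 1 := by omega
  have hd : d = 0 ∨ d = 1 := by omega
  rcases hc with rfl | rfl <;> rcases hd with rfl | rfl <;>
    simp [crossW, Fin.sum_univ_two] <;> ring

theorem rowT_eq (q s x : ℂ) (β τ : Ptn) :
    rowT q s x β τ = ∑ b, rowZ (weightL q s x) 0 b (ptnEquiv β) (ptnEquiv τ) := by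
  simp [rowT, rowPF_eq]

theorem rowTstar_eq (q s x : ℂ) (β τ : Ptn) :
    rowTstar q s x β τ = ∑ b, rowZ (weightM q s x) 1 b (ptnEquiv β) (ptnEquiv τ) := by
  simp [rowTstar, rowPF_eq]

/-- Both right boundaries are free, so the intertwining relation is summed over `a` and `b`, and the
cross contributes only its row sum. -/
theorem rowTstar_rowT_comm (hx : 1 - s * x ≠ 0) (hy : 1 - s * y ≠ 0)
    (h : ‖(x - s) * (y - s)‖ < ‖(1 - s * x) * (1 - s * y)‖) (β τ : Ptn) :
    (1 - x * y) * ∑' κ, rowTstar q s y β κ * rowT q s x κ τ =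
      (1 - q * x * y) * ∑' κ, rowT q s x β κ * rowTstar q s y κ τ := by
  have hL := conserving_weightL (q := q) hx
  have hM := conserving_weightM (q := q) hy
  have e1 : ∑' κ, rowTstar q s y β κ * rowT q s x κ τ =
      ∑ a, ∑ b, pairZ (weightM q s y) (weightL q s x) 1 0 a b (ptnEquiv β) (ptnEquiv τ) := by
    refine (ptnEquiv.symm.tsum_eq _).symm.trans ?_
    refine Eq.trans (tsum_congr fun κ => ?_) (HasSum.tsum_eq (hasSum_sum fun a (_ : a ∈ Finset.univ) =>
      hasSum_sum fun b (_ : b ∈ Finset.univ) => ((summable_raise_lower hM hL (norm_weight_mul_lt_one hx hy h) a b (ptnEquiv β)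
        (ptnEquiv τ)).of_norm.hasSum)))
    simp only [rowT_eq, rowTstar_eq, Equiv.apply_symm_apply, Finset.sum_mul_sum]
  have e2 : ∑' κ, rowT q s x β κ * rowTstar q s y κ τ =
      ∑ a, ∑ b, pairZ (weightL q s x) (weightM q s y) 0 1 b a (ptnEquiv β) (ptnEquiv τ) := by
    refine (ptnEquiv.symm.tsum_eq _).symm.trans ?_
    refine Eq.trans (tsum_congr fun κ => ?_) (HasSum.tsum_eq (hasSum_sum fun a (_ : a ∈ Finset.univ) =>
      hasSum_sum fun b (_ : b ∈ Finset.univ) => ((summable_lower_raise hL (fun κ => rowZ (weightM q s y) 1 a κ (ptnEquiv τ)) b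
        (ptnEquiv β)).of_norm.hasSum)))
    simp only [rowT_eq, rowTstar_eq, Equiv.apply_symm_apply, Fin.sum_univ_two]
    ring
  have e3 := fun c d => sum_crossW q x y c d
  have e4 := pairZ_intertwine (q := q) hx hy h (ptnEquiv β) (ptnEquiv τ)
  rw [e1, e2]
  simp only [Fin.sum_univ_two] at e3 e4 ⊢
  linear_combination e4 0 0 + e4 0 1 + e4 1 0 + e4 1 1 +
    pairZ (weightL q s x) (weightM q s y) 0 1 0 0 (ptnEquiv β) (ptnEquiv τ) * e3 0 0 +
    pairZ (weightL q s x) (weightM q s y) 0 1 1 0 (ptnEquiv β) (ptnEquiv τ) * e3 0 1 +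
    pairZ (weightL q s x) (weightM q s y) 0 1 0 1 (ptnEquiv β) (ptnEquiv τ) * e3 1 0 +
    pairZ (weightL q s x) (weightM q s y) 0 1 1 1 (ptnEquiv β) (ptnEquiv τ) * e3 1 1

end Commutation

/-! ### Decaying vectors and associativity of infinite products -/

/-- Functions on partitions with a bounded number of parts, which are bounded by `r ^ |κ|` for
all `r > u`. -/
structure Decay (u : ℝ) (φ : Ptn → ℂ) : Prop where
  len_le : ∃ L, ∀ κ, φ κ ≠ 0 → len κ ≤ L
  norm_le : ∀ r > u, ∃ C : ℝ, 0 ≤ C ∧ ∀ κ, ‖φ κ‖ ≤ C * r ^ κ.1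

/-- Matrices whose elements `A β τ` vanish unless `|τ| ≤ |β|` and `ℓ(τ) ≤ ℓ(β) ≤ ℓ(τ) + 1`, and
which are bounded by `r ^ (|β| - |τ|)` for all `r > u`. -/
structure Lowers (u : ℝ) (A : Ptn → Ptn → ℂ) : Prop where
  size_le : ∀ {β τ}, A β τ ≠ 0 → τ.1 ≤ β.1
  len_le : ∀ {β τ}, A β τ ≠ 0 → len β ≤ len τ + 1 ∧ len τ ≤ len β
  norm_le : ∀ r > u, ∀ L, ∃ C : ℝ, 0 ≤ C ∧ ∀ β τ, len β ≤ L → len τ ≤ L →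
    ‖A β τ‖ * r ^ τ.1 ≤ C * r ^ β.1

/-- The action of a matrix on column vectors. -/
def app (A : Ptn → Ptn → ℂ) (φ : Ptn → ℂ) (β : Ptn) : ℂ := ∑' τ, A β τ * φ τ

section Vectors

variable {u v : ℝ} {A : Ptn → Ptn → ℂ} {φ ψ : Ptn → ℂ}

theorem Decay.of_norm_le (hψ : Decay u ψ) (h : ∀ κ, ‖φ κ‖ ≤ ‖ψ κ‖) : Decay u φ := by
  constructor
  · obtain ⟨L, hL⟩ := hψ.len_le
    refine ⟨L, fun κ hκ => hL κ fun h0 => hκ ?_⟩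
    simpa [h0] using h κ
  · intro r hr
    obtain ⟨C, hC, hCb⟩ := hψ.norm_le r hr
    exact ⟨C, hC, fun κ => (h κ).trans (hCb κ)⟩

theorem Decay.of_finite_support (hu : 0 ≤ u) (h : (Function.support φ).Finite) : Decay u φ := by
  constructor
  · obtain ⟨L, hL⟩ := Finset.exists_le (h.toFinset.image len)
    exact ⟨L, fun κ hκ => hL _ (Finset.mem_image_of_mem _ (by simpa using hκ))⟩
  · intro r hr
    have r0 : 0 < r := hu.trans_lt hr
    obtain ⟨C, hC⟩ := Finset.exists_le (h.toFinset.image fun κ => ‖φ κ‖ / r ^ κ.1)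
    refine ⟨max C 0, le_max_right _ _, fun κ => ?_⟩
    by_cases hκ : φ κ = 0
    · rw [hκ, norm_zero]
      positivity
    · rw [← div_le_iff₀ (by positivity)]
      exact (hC _ (Finset.mem_image_of_mem (fun κ : Ptn => ‖φ κ‖ / r ^ κ.1)
        (by simpa using hκ))).trans (le_max_left _ _)

theorem Lowers.finite_support (hA : Lowers u A) (β : Ptn) : (Function.support (A β)).Finite :=
  (finite_size_le β.1).subset fun _ h => hA.size_le h

theorem Lowers.summable_norm (hA : Lowers u A) (φ : Ptn → ℂ) (β : Ptn) :
    Summable fun τ => ‖A β τ‖ * ‖φ τ‖ :=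
  summable_of_hasFiniteSupport ((hA.finite_support β).subset fun τ hτ h0 => hτ (by simp [h0]))

theorem Decay.app_norm (hu : 0 ≤ u) (hA : Lowers u A) (hφ : Decay u φ) :
    Decay u fun β => ((∑' τ, ‖A β τ‖ * ‖φ τ‖ : ℝ) : ℂ) := by
  obtain ⟨L, hL⟩ := hφ.len_le
  have hlen : ∀ β τ, ‖A β τ‖ * ‖φ τ‖ ≠ 0 → len τ ≤ L ∧ len β ≤ L + 1 := by
    intro β τ h
    have h1 := hL τ fun h0 => h (by simp [h0])
    have h2 := (hA.len_le fun h0 : A β τ = 0 => h (by simp [h0])).1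
    omega
  constructor
  · refine ⟨L + 1, fun β hβ => ?_⟩
    by_contra hcon
    refine hβ ?_
    rw [Complex.ofReal_eq_zero]
    refine (tsum_congr fun τ => ?_).trans tsum_zero
    by_contra h
    exact hcon (hlen β τ h).2
  · intro r hr
    -- The room between `r'` and `r` pays for the sum over `τ`: as `|τ| ≤ |β|`, the spare factor
    -- `(r' / r) ^ |β|` is at most the summable `(r' / r) ^ |τ|`. This is why `Decay` asks for all
    -- `r > u`.
    obtain ⟨r', hr', hrr'⟩ := exists_between hr
    have r0 : 0 < r := hu.trans_lt hr
    have r0' : 0 < r' := hu.trans_lt hr'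
    obtain ⟨C, hC, hCb⟩ := hA.norm_le r' hr' (L + 1)
    obtain ⟨D, hD, hDb⟩ := hφ.norm_le r' hr'
    have hρ1 : r' / r < 1 := (div_lt_one r0).2 hrr'
    have hs := summable_pow_size (div_pos r0' r0).le hρ1 L
    have hind : ∀ κ : Ptn, 0 ≤ ({κ : Ptn | len κ ≤ L}.indicator fun κ => (r' / r) ^ κ.1) κ :=
      Set.indicator_nonneg fun _ _ => by positivity
    refine ⟨C * D * ∑' κ : Ptn, ({κ : Ptn | len κ ≤ L}.indicator fun κ => (r' / r) ^ κ.1) κ,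
      mul_nonneg (mul_nonneg hC hD) (tsum_nonneg hind), fun β => ?_⟩
    rw [Complex.norm_real, Real.norm_of_nonneg (tsum_nonneg fun _ => by positivity), mul_assoc,
      mul_comm (tsum _), ← mul_assoc, ← tsum_mul_left]
    refine (hA.summable_norm φ β).tsum_le_tsum (fun τ => ?_) (hs.mul_left _)
    by_cases h : ‖A β τ‖ * ‖φ τ‖ = 0
    · rw [h]
      exact mul_nonneg (by positivity) (hind τ)
    · have hl := hlen β τ h
      have hsz := hA.size_le fun h0 : A β τ = 0 => h (by simp [h0])
      rw [Set.indicator_of_mem (show τ ∈ {κ : Ptn | len κ ≤ L} from hl.1)]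
      calc ‖A β τ‖ * ‖φ τ‖ ≤ ‖A β τ‖ * (D * r' ^ τ.1) := by gcongr; exact hDb τ
        _ = ‖A β τ‖ * r' ^ τ.1 * D := by ring
        _ ≤ C * r' ^ β.1 * D := 
          mul_le_mul_of_nonneg_right (hCb β τ hl.2 (by omega)) hD
        _ = C * D * r ^ β.1 * (r' / r) ^ β.1 := by
          rw [div_pow]
          field_simp
        _ ≤ C * D * r ^ β.1 * (r' / r) ^ τ.1 := by
          gcongr C * D * r ^ β.1 * ?_
          exact pow_le_pow_of_le_one (by positivity) hρ1.le hsz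

theorem Decay.app (hu : 0 ≤ u) (hA : Lowers u A) (hφ : Decay u φ) : Decay u (app A φ) := by
  refine (hφ.app_norm hu hA).of_norm_le fun β => ?_
  rw [Complex.norm_real, Real.norm_of_nonneg (tsum_nonneg fun _ => by positivity)]
  simp only [← norm_mul]
  refine norm_tsum_le_tsum_norm ?_
  simpa only [norm_mul] using hA.summable_norm φ β

theorem Decay.summable_norm_mul (hu : 0 ≤ u) (hv : 0 ≤ v) (huv : u * v < 1) (hψ : Decay v ψ)
    (hφ : Decay u φ) : Summable fun κ => ‖ψ κ‖ * ‖φ κ‖ := by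
  obtain ⟨r, r', hr, hr', hrr⟩ := exists_radii huv
  have r0 : 0 < r := hu.trans_lt hr
  have r0' : 0 < r' := hv.trans_lt hr'
  obtain ⟨L, hL⟩ := hφ.len_le
  obtain ⟨C, hC, hCb⟩ := hφ.norm_le r hr
  obtain ⟨D, hD, hDb⟩ := hψ.norm_le r' hr'
  refine Summable.of_nonneg_of_le (fun _ => by positivity) (fun κ => ?_)
    ((summable_pow_size (mul_pos r0 r0').le hrr L).mul_left (C * D))
  by_cases h : φ κ = 0
  · rw [h, norm_zero, mul_zero]
    exact mul_nonneg (by positivity) (Set.indicator_nonneg (fun _ _ => by positivity) _)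
  · rw [Set.indicator_of_mem (show κ ∈ {κ : Ptn | len κ ≤ L} from hL κ h)]
    calc ‖ψ κ‖ * ‖φ κ‖ ≤ (D * r' ^ κ.1) * (C * r ^ κ.1) := by
          gcongr
          · exact hDb κ
          · exact hCb κ
      _ = _ := by rw [mul_pow]; ring

/-- Fubini: the vector with entries `∑ |A β τ| |φ τ|` still decays at rate `u`, so it pairs
absolutely with `ψ`. -/
theorem tsum_mul_app (hu : 0 ≤ u) (hv : 0 ≤ v) (huv : u * v < 1) (hψ : Decay v ψ)
    (hA : Lowers u A) (hφ : Decay u φ) :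
    ∑' κ, ψ κ * app A φ κ = ∑' τ, (∑' κ, ψ κ * A κ τ) * φ τ := by
  have hs : Summable fun p : Ptn × Ptn => ψ p.1 * (A p.1 p.2 * φ p.2) := by
    refine Summable.of_norm ((summable_prod_of_nonneg fun _ => norm_nonneg _).2 ⟨fun κ => ?_, ?_⟩)
    · simpa only [norm_mul] using (hA.summable_norm φ κ).mul_left ‖ψ κ‖
    · have := hψ.summable_norm_mul hu hv huv (hφ.app_norm hu hA)
      refine this.congr fun κ => ?_
      rw [Complex.norm_real, Real.norm_of_nonneg (tsum_nonneg fun _ => by positivity),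
        ← tsum_mul_left]
      simp only [norm_mul]
  simp only [SSHL.app, ← tsum_mul_left, ← tsum_mul_right]
  rw [← Summable.tsum_comm (f := fun κ τ => ψ κ * (A κ τ * φ τ)) hs]
  simp only [mul_assoc]

theorem tsum_mul_app' {B : Ptn → Ptn → ℂ} (hu : 0 ≤ u) (hv : 0 ≤ v) (huv : u * v < 1)
    (hψ : Decay v ψ) (hB : Lowers v fun τ β => B β τ) (hφ : Decay u φ) :
    ∑' κ, ψ κ * app B φ κ = ∑' τ, (∑' κ, ψ κ * B κ τ) * φ τ := by
  have := tsum_mul_app hv hu (mul_comm u v ▸ huv) hφ hB hψ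
  simp only [SSHL.app, mul_comm] at this ⊢
  exact this.symm

theorem app_const_smul (A : Ptn → Ptn → ℂ) (c : ℂ) (φ : Ptn → ℂ) :
    app A (c • φ) = c • app A φ := by
  funext β
  simp only [app, Pi.smul_apply, smul_eq_mul, ← tsum_mul_left]
  exact tsum_congr fun τ => by ring

theorem Decay.row {B : Ptn → Ptn → ℂ} (hv : 0 ≤ v) (hB : Lowers v fun τ β => B β τ) (β : Ptn) :
    Decay v (B β) := by
  classical
  have h := Decay.app hv hB (Decay.of_finite_support hv (φ := Pi.single β 1)
    ((Set.finite_singleton β).subset (Pi.support_single_subset)))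
  refine h.of_norm_le fun κ => le_of_eq (congrArg _ ?_)
  rw [SSHL.app, tsum_eq_single β fun τ hτ => by simp [hτ]]
  simp

/-- Each row of `B` decays at rate `v` and each row of `A` is finite, so both compositions may be
reassociated and the relation between matrix entries applied. -/
theorem app_app_comm {B : Ptn → Ptn → ℂ} {p p' : ℂ} (hu : 0 ≤ u) (hv : 0 ≤ v) (huv : u * v < 1)
    (hA : Lowers u A) (hB : Lowers v fun τ β => B β τ)
    (h : ∀ β τ, p * ∑' κ, B β κ * A κ τ = p' * ∑' κ, A β κ * B κ τ) (hφ : Decay u φ) :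
    p • app B (app A φ) = p' • app A (app B φ) := by
  funext β
  have e1 := tsum_mul_app hu hv huv (Decay.row hv hB β) hA hφ
  have e2 := tsum_mul_app' hu hv huv (Decay.of_finite_support hv (hA.finite_support β)) hB hφ
  simp only [Pi.smul_apply, smul_eq_mul]
  rw [SSHL.app, e1, SSHL.app, e2, ← tsum_mul_left, ← tsum_mul_left]
  refine tsum_congr fun τ => ?_
  rw [← mul_assoc, h, mul_assoc]

end Vectors

/-! ### Finite products of row operators -/

section Products

variable {l : List (Ptn → Ptn → ℂ)}

/-- A matrix whose elements `A β τ` vanish unless `|τ| ≤ |β|`. -/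
def SizeLowers (A : Ptn → Ptn → ℂ) : Prop := ∀ β τ, A β τ ≠ 0 → τ.1 ≤ β.1

/-- A matrix whose elements `A β τ` vanish unless `|β| ≤ |τ|`. -/
def SizeRaises (A : Ptn → Ptn → ℂ) : Prop := ∀ β τ, A β τ ≠ 0 → β.1 ≤ τ.1

/-- The finite set of partitions of size at most `N`. -/
def sizeLE (N : ℕ) : Finset Ptn := (finite_size_le N).toFinset

@[simp] theorem mem_sizeLE {N : ℕ} {κ : Ptn} : κ ∈ sizeLE N ↔ κ.1 ≤ N := by simp [sizeLE]

theorem sizeRaises_matProd (h : ∀ B ∈ l, SizeRaises B) : SizeRaises (matProd l) := by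
  induction l with
  | nil =>
    intro β τ hne
    simp only [matProd, ne_eq, ite_eq_right_iff, one_ne_zero, imp_false, not_not] at hne
    rw [hne]
  | cons B l ih =>
    intro β τ hne
    obtain ⟨κ, hκ⟩ : ∃ κ, B β κ * matProd l κ τ ≠ 0 := by
      by_contra! hcon
      exact hne (finsum_eq_zero_of_forall_eq_zero hcon)
    exact (h B (by simp) _ _ (left_ne_zero_of_mul hκ)).trans
      (ih (fun B hB => h B (by simp [hB])) _ _ (right_ne_zero_of_mul hκ))

theorem sizeLowers_matProd (h : ∀ B ∈ l, SizeLowers B) : SizeLowers (matProd l) := by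
  induction l with
  | nil =>
    intro β τ hne
    simp only [matProd, ne_eq, ite_eq_right_iff, one_ne_zero, imp_false, not_not] at hne
    rw [hne]
  | cons B l ih =>
    intro β τ hne
    obtain ⟨κ, hκ⟩ : ∃ κ, B β κ * matProd l κ τ ≠ 0 := by
      by_contra! hcon
      exact hne (finsum_eq_zero_of_forall_eq_zero hcon)
    exact (ih (fun B hB => h B (by simp [hB])) _ _ (right_ne_zero_of_mul hκ)).trans
      (h B (by simp) _ _ (left_ne_zero_of_mul hκ))

theorem matProd_cons_raises (B : Ptn → Ptn → ℂ) (h : SizeRaises (matProd l)) (β τ : Ptn) {N : ℕ}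
    (hN : τ.1 ≤ N) : matProd (B :: l) β τ = ∑ κ ∈ sizeLE N, B β κ * matProd l κ τ :=
  finsum_eq_sum_of_support_subset _ fun κ hκ => by
    simpa using (h κ τ (right_ne_zero_of_mul hκ)).trans hN

theorem matProd_cons_lowers {B : Ptn → Ptn → ℂ} (h : SizeLowers B) (β τ : Ptn) {N : ℕ}
    (hN : β.1 ≤ N) : matProd (B :: l) β τ = ∑ κ ∈ sizeLE N, B β κ * matProd l κ τ :=
  finsum_eq_sum_of_support_subset _ fun κ hκ => by
    simpa using (h β κ (left_ne_zero_of_mul hκ)).trans hN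

/-- `matProd` unfolds from the left, but the `T*` adjacent to the `T` is the last one, so it must be
split off on the right. -/
theorem matProd_append_raises {B : Ptn → Ptn → ℂ} (hl : ∀ B ∈ l, SizeRaises B)
    (hB : SizeRaises B) (β τ : Ptn) {N : ℕ} (hN : τ.1 ≤ N) :
    matProd (l ++ [B]) β τ = ∑ κ ∈ sizeLE N, matProd l β κ * B κ τ := by
  induction l generalizing β with
  | nil =>
    have h0 : SizeRaises (matProd []) := sizeRaises_matProd (by simp)
    rw [List.nil_append, matProd_cons_raises B h0 β τ hN]
    by_cases hβ : β.1 ≤ N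
    · rw [Finset.sum_eq_single τ (fun κ _ hκ => by simp [matProd, hκ]) (by simp [hN]),
        Finset.sum_eq_single β (fun κ _ hκ => by simp [matProd, hκ.symm]) (by simp [hβ])]
      simp [matProd]
    · rw [Finset.sum_eq_zero, Finset.sum_eq_zero]
      · intro κ hκ
        by_contra hne
        exact hβ ((h0 β κ (left_ne_zero_of_mul hne)).trans (by simpa using hκ))
      · intro κ hκ
        by_contra hne
        exact hβ ((hB β κ (left_ne_zero_of_mul hne)).trans (by simpa using hκ))
  | cons A l ih =>
    have hl' : ∀ B ∈ l, SizeRaises B := fun B hB => hl B (by simp [hB])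
    have h1 : SizeRaises (matProd (l ++ [B])) := sizeRaises_matProd (by
      intro C hC
      rcases List.mem_append.1 hC with h | h
      · exact hl' C h
      · rwa [List.mem_singleton.1 h])
    rw [List.cons_append, matProd_cons_raises A h1 β τ hN]
    simp only [ih hl', Finset.mul_sum]
    rw [Finset.sum_comm]
    refine Finset.sum_congr rfl fun κ hκ => ?_
    rw [matProd_cons_raises A (sizeRaises_matProd hl') β κ (mem_sizeLE.1 hκ), Finset.sum_mul]
    exact Finset.sum_congr rfl fun _ _ => by ring

/-- The action of a product of matrices on column vectors. -/
def appList (l : List (Ptn → Ptn → ℂ)) (φ : Ptn → ℂ) : Ptn → ℂ := l.foldr app φ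

@[simp] theorem appList_nil (φ : Ptn → ℂ) : appList [] φ = φ := rfl

@[simp] theorem appList_cons (A : Ptn → Ptn → ℂ) (φ : Ptn → ℂ) :
    appList (A :: l) φ = app A (appList l φ) := rfl

theorem appList_matProd_raises (h : ∀ B ∈ l, SizeRaises B) (μ : Ptn) :
    appList l (fun κ => matProd [] κ μ) = fun κ => matProd l κ μ := by
  induction l with
  | nil => rfl
  | cons B l ih =>
    have h' : ∀ B ∈ l, SizeRaises B := fun B hB => h B (by simp [hB])
    funext κ
    rw [appList_cons, ih h', app, matProd_cons_raises B (sizeRaises_matProd h') κ μ le_rfl]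
    refine tsum_eq_sum fun ν hν => ?_
    by_contra hne
    exact hν (by simpa using sizeRaises_matProd h' ν μ (right_ne_zero_of_mul hne))

theorem SizeLowers.app_eq {B : Ptn → Ptn → ℂ} (h : SizeLowers B) (φ : Ptn → ℂ) (β : Ptn) {N : ℕ}
    (hN : β.1 ≤ N) : app B φ β = ∑ κ ∈ sizeLE N, B β κ * φ κ :=
  tsum_eq_sum fun κ hκ => by
    by_contra hne
    exact hκ (by simpa using (h β κ (left_ne_zero_of_mul hne)).trans hN)

theorem appList_lowers (h : ∀ B ∈ l, SizeLowers B) (φ : Ptn → ℂ) (β : Ptn) {N : ℕ}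
    (hN : β.1 ≤ N) : appList l φ β = ∑ κ ∈ sizeLE N, matProd l β κ * φ κ := by
  induction l generalizing β with
  | nil =>
    rw [Finset.sum_eq_single β (fun κ _ hκ => by simp [matProd, hκ.symm]) (by simp [hN])]
    simp [matProd]
  | cons B l ih =>
    have h' : ∀ B ∈ l, SizeLowers B := fun B hB => h B (by simp [hB])
    have hB : SizeLowers B := h B (by simp)
    rw [appList_cons, hB.app_eq _ β hN,
      Finset.sum_congr rfl fun κ hκ => by rw [ih h' κ (mem_sizeLE.1 hκ)]]
    simp only [Finset.mul_sum, matProd_cons_lowers hB β _ hN, Finset.sum_mul]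
    rw [Finset.sum_comm]
    exact Finset.sum_congr rfl fun _ _ => Finset.sum_congr rfl fun _ _ => by ring

theorem tsum_matProd_lowers (h : ∀ B ∈ l, SizeLowers B) (φ : Ptn → ℂ) (β : Ptn) :
    ∑' κ, matProd l β κ * φ κ = appList l φ β := by
  rw [appList_lowers h φ β le_rfl]
  refine tsum_eq_sum fun κ hκ => ?_
  by_contra hne
  exact hκ (by simpa using sizeLowers_matProd h β κ (left_ne_zero_of_mul hne))

theorem appList_matProd_lowers (h : ∀ B ∈ l, SizeLowers B) (μ : Ptn) :
    appList l (fun κ => matProd [] κ μ) = fun κ => matProd l κ μ := by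
  funext β
  rw [← tsum_matProd_lowers h, tsum_eq_single μ (fun κ hκ => by simp [matProd, hκ])]
  simp [matProd]

theorem finite_support_delta (μ : Ptn) :
    (Function.support fun κ => matProd [] κ μ).Finite :=
  (Set.finite_singleton μ).subset fun κ hκ => by simpa [matProd] using hκ

theorem finite_support_app {B : Ptn → Ptn → ℂ} (hB : SizeRaises B) {φ : Ptn → ℂ}
    (hφ : (Function.support φ).Finite) : (Function.support (app B φ)).Finite := by
  obtain ⟨N, hN⟩ := Finset.exists_le (hφ.toFinset.image Sigma.fst)
  refine (finite_size_le N).subset fun β hβ => ?_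
  have : ∃ τ, B β τ * φ τ ≠ 0 := by
    by_contra! hcon
    exact hβ ((tsum_congr hcon).trans tsum_zero)
  obtain ⟨τ, hτ⟩ := this
  exact (hB β τ (left_ne_zero_of_mul hτ)).trans (hN _ (Finset.mem_image_of_mem _
    (by simpa using right_ne_zero_of_mul hτ)))

end Products

/-! ### The skew Cauchy identity -/

variable {q s : ℂ} {u v : ℝ}

theorem lowers_rowT {x : ℂ} (hx : 1 - s * x ≠ 0) (h : ‖(x - s) / (1 - s * x)‖ ≤ u) :
    Lowers u (rowT q s x) := by
  have hL := conserving_weightL (q := q) hx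
  have hex : ∀ {β τ}, rowT q s x β τ ≠ 0 →
      ∃ b, rowZ (weightL q s x) 0 b (ptnEquiv β) (ptnEquiv τ) ≠ 0 := by
    intro β τ hne
    rw [rowT_eq] at hne
    obtain ⟨b, -, hb⟩ := Finset.exists_ne_zero_of_sum_ne_zero hne
    exact ⟨b, hb⟩
  refine ⟨fun hne => ?_, fun hne => ?_, fun r hr L => ?_⟩
  · obtain ⟨b, hb⟩ := hex hne
    simpa using wt_le_of_rowZ_ne_zero hL _ _ b hb
  · obtain ⟨b, hb⟩ := hex hne
    have := rowZ_cons hL _ _ b hb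
    simp only [card_ptnEquiv, Fin.val_zero] at this
    omega
  · have h0 : 0 < r := ((norm_nonneg _).trans h).trans_lt hr
    obtain ⟨C, hC, hCb⟩ := exists_rowZ_bound hL h0 (by
      simpa [weightL] using h.trans hr.le) L
    refine ⟨C + C, by positivity, fun β τ hβ hτ => ?_⟩
    have e := fun b => hCb (ptnEquiv β) (ptnEquiv τ) (by simpa using hβ) (by simpa using hτ) b
    simp only [wt_ptnEquiv] at e
    rw [rowT_eq, Fin.sum_univ_two, add_mul]
    calc _ ≤ (‖_‖ + ‖_‖) * r ^ τ.1 := by gcongr; exact norm_add_le _ _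
      _ ≤ _ := by rw [add_mul]; exact add_le_add (e 0) (e 1)

theorem lowers_rowTstar {y : ℂ} (hy : 1 - s * y ≠ 0) (h : ‖(y - s) / (1 - s * y)‖ ≤ v) :
    Lowers v fun τ β => rowTstar q s y β τ := by
  have hM := conserving_weightM (q := q) hy
  have hex : ∀ {β τ}, rowTstar q s y β τ ≠ 0 →
      ∃ b, rowZ (weightM q s y) 1 b (ptnEquiv β) (ptnEquiv τ) ≠ 0 := by
    intro β τ hne
    rw [rowTstar_eq] at hne
    obtain ⟨b, -, hb⟩ := Finset.exists_ne_zero_of_sum_ne_zero hne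
    exact ⟨b, hb⟩
  refine ⟨fun hne => ?_, fun hne => ?_, fun r hr L => ?_⟩
  · obtain ⟨b, hb⟩ := hex hne
    simpa using wt_le_of_rowZ_ne_zero' hM _ _ b hb
  · obtain ⟨b, hb⟩ := hex hne
    have := rowZ_cons hM _ _ b hb
    simp only [card_ptnEquiv, Fin.val_one] at this
    omega
  · have h0 : 0 < r := ((norm_nonneg _).trans h).trans_lt hr
    obtain ⟨C, hC, hCb⟩ := exists_rowZ_bound' hM h0 (by
      simpa [weightM] using h.trans hr.le) L
    refine ⟨C + C, by positivity, fun τ β hτ hβ => ?_⟩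
    have e := fun b => hCb (ptnEquiv β) (ptnEquiv τ) (by simpa using hβ) (by simpa using hτ) b
    simp only [wt_ptnEquiv] at e
    rw [rowTstar_eq, Fin.sum_univ_two, add_mul]
    calc _ ≤ (‖_‖ + ‖_‖) * r ^ β.1 := by gcongr; exact norm_add_le _ _
      _ ≤ _ := by rw [add_mul]; exact add_le_add (e 0) (e 1)

/-- A spectral parameter whose factor of an empty column is at most `u` in absolute value. -/
def Adm (s : ℂ) (u : ℝ) (x : ℂ) : Prop := 1 - s * x ≠ 0 ∧ ‖(x - s) / (1 - s * x)‖ ≤ u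

theorem Adm.norm_lt {x y : ℂ} (hx : Adm s u x) (hy : Adm s v y) (huv : u * v < 1) :
    ‖(x - s) * (y - s)‖ < ‖(1 - s * x) * (1 - s * y)‖ := by
  rw [← div_lt_one (norm_pos_iff.2 (mul_ne_zero hx.1 hy.1)), ← norm_div, mul_div_mul_comm,
    norm_mul]
  exact (mul_le_mul hx.2 hy.2 (norm_nonneg _) ((norm_nonneg _).trans hx.2)).trans_lt huv

theorem Adm.sizeLowers {x : ℂ} (hx : Adm s u x) : SizeLowers (rowT q s x) :=
  fun _ _ h => (lowers_rowT hx.1 hx.2).size_le h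

theorem Adm.sizeRaises {y : ℂ} (hy : Adm s v y) : SizeRaises (rowTstar q s y) :=
  fun _ _ h => (lowers_rowTstar hy.1 hy.2).size_le h

theorem decay_appList_rowT {xs : List ℂ} (hu : 0 ≤ u) (hxs : ∀ x ∈ xs, Adm s u x) {φ : Ptn → ℂ}
    (hφ : Decay u φ) : Decay u (appList (xs.map (rowT q s)) φ) := by
  induction xs with
  | nil => exact hφ
  | cons x xs ih =>
    have hx := hxs x (by simp)
    exact Decay.app hu (lowers_rowT hx.1 hx.2) (ih fun x hx => hxs x (by simp [hx]))

theorem decay_matProd_rowTstar {ys : List ℂ} (hv : 0 ≤ v) (hys : ∀ y ∈ ys, Adm s v y) (β : Ptn) :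
    Decay v (matProd (ys.map (rowTstar q s)) β) := by
  induction ys using List.reverseRecOn with
  | nil =>
    refine Decay.of_finite_support hv ((Set.finite_singleton β).subset fun κ hκ => ?_)
    have : β = κ := by simpa [matProd] using hκ
    exact this.symm
  | append_singleton ys y ih =>
    have hys' : ∀ y ∈ ys, Adm s v y := fun y hy => hys y (by simp [hy])
    have hy := hys y (by simp)
    refine (Decay.app hv (lowers_rowTstar (q := q) hy.1 hy.2) (ih hys')).of_norm_le
      fun κ => le_of_eq (congrArg _ ?_)
    rw [List.map_append, List.map_singleton, matProd_append_raises _ hy.sizeRaises β κ le_rfl, app]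
    · refine ((tsum_congr fun τ => mul_comm _ _).trans (tsum_eq_sum fun τ hτ => ?_)).symm
      by_contra hne
      exact hτ (by simpa using hy.sizeRaises τ κ (right_ne_zero_of_mul hne))
    · intro B hB
      obtain ⟨y', hy', rfl⟩ := List.mem_map.1 hB
      exact (hys' y' hy').sizeRaises

theorem rowTstar_appList_rowT {xs : List ℂ} {y : ℂ} (hu : 0 ≤ u) (hv : 0 ≤ v) (huv : u * v < 1)
    (hxs : ∀ x ∈ xs, Adm s u x) (hy : Adm s v y) {φ : Ptn → ℂ} (hφ : Decay u φ) :
    (xs.map fun x => 1 - x * y).prod • app (rowTstar q s y) (appList (xs.map (rowT q s)) φ) =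
      (xs.map fun x => 1 - q * x * y).prod •
        appList (xs.map (rowT q s)) (app (rowTstar q s y) φ) := by
  induction xs with
  | nil => rfl
  | cons x xs ih =>
    have hxs' : ∀ x ∈ xs, Adm s u x := fun x hx => hxs x (by simp [hx])
    have hx := hxs x (by simp)
    have h1 := app_app_comm hu hv huv (lowers_rowT (q := q) hx.1 hx.2)
      (lowers_rowTstar (q := q) hy.1 hy.2)
      (rowTstar_rowT_comm hx.1 hy.1 (hx.norm_lt hy huv)) (decay_appList_rowT (q := q) hu hxs' hφ)
    simp only [List.map_cons, List.prod_cons, appList_cons]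
    rw [mul_comm (1 - x * y), mul_smul, h1, smul_comm, ← app_const_smul, ih hxs', app_const_smul,
      mul_smul]

/-- The last `T*` is moved from the row vector onto the column vector, past all `T`, and absorbed
into `φ`. Since `T*` raises sizes, `φ` keeps finite support and the induction continues. -/
theorem tsum_matProd_appList {xs ys : List ℂ} (hu : 0 ≤ u) (hv : 0 ≤ v) (huv : u * v < 1)
    (hxs : ∀ x ∈ xs, Adm s u x) (hys : ∀ y ∈ ys, Adm s v y) {φ : Ptn → ℂ}
    (hφ : (Function.support φ).Finite) (β : Ptn) :
    (ys.map fun y => (xs.map fun x => 1 - x * y).prod).prod *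
        ∑' κ, matProd (ys.map (rowTstar q s)) β κ * appList (xs.map (rowT q s)) φ κ =
      (ys.map fun y => (xs.map fun x => 1 - q * x * y).prod).prod *
        appList (xs.map (rowT q s)) (appList (ys.map (rowTstar q s)) φ) β := by
  induction ys using List.reverseRecOn generalizing φ with
  | nil =>
    simp only [List.map_nil, List.prod_nil, one_mul, appList_nil]
    rw [tsum_eq_single β fun κ hκ => by simp [matProd, hκ.symm]]
    simp [matProd]
  | append_singleton ys y ih =>
    have hys' : ∀ y ∈ ys, Adm s v y := fun y hy => hys y (by simp [hy])
    have hy := hys y (by simp)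
    have hB : ∀ B ∈ ys.map (rowTstar q s), SizeRaises B := by
      intro B hB
      obtain ⟨y', hy', rfl⟩ := List.mem_map.1 hB
      exact (hys' y' hy').sizeRaises
    have hφ' := Decay.of_finite_support hu hφ
    have e1 : ∀ κ, matProd ((ys ++ [y]).map (rowTstar q s)) β κ =
        ∑' ν, matProd (ys.map (rowTstar q s)) β ν * rowTstar q s y ν κ := by
      intro κ
      rw [List.map_append, List.map_singleton, matProd_append_raises hB hy.sizeRaises β κ le_rfl]
      refine (tsum_eq_sum fun τ hτ => ?_).symm
      by_contra hne
      exact hτ (by simpa using hy.sizeRaises τ κ (right_ne_zero_of_mul hne))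
    have e2 := rowTstar_appList_rowT (q := q) hu hv huv hxs hy hφ'
    have e3 := ih hys' (finite_support_app (hy.sizeRaises (q := q)) hφ)
    have e4 : appList ((ys ++ [y]).map (rowTstar q s)) φ =
        appList (ys.map (rowTstar q s)) (app (rowTstar q s y) φ) := by
      simp [appList]
    simp only [e1, e4]
    rw [← tsum_mul_app' hu hv huv (decay_matProd_rowTstar hv hys' β)
      (lowers_rowTstar (q := q) hy.1 hy.2) (decay_appList_rowT hu hxs hφ'), List.map_append,
      List.map_append, List.prod_append, List.prod_append, List.map_singleton,
      List.map_singleton, List.prod_singleton, List.prod_singleton, mul_assoc, ← tsum_mul_left,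
      mul_right_comm, ← e3, mul_assoc, ← tsum_mul_right]
    congr 1
    refine tsum_congr fun κ => ?_
    have := congrFun e2 κ
    simp only [Pi.smul_apply, smul_eq_mul] at this
    linear_combination matProd (ys.map (rowTstar q s)) β κ * this

theorem skew_cauchy_of_adm {xs ys : List ℂ} (hu : 0 ≤ u) (hv : 0 ≤ v) (huv : u * v < 1)
    (hxs : ∀ x ∈ xs, Adm s u x) (hys : ∀ y ∈ ys, Adm s v y) (lam mu : Ptn) :
    (Summable fun κ => matProd (ys.map (rowTstar q s)) lam κ * matProd (xs.map (rowT q s)) κ mu) ∧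
    (Summable fun ν => matProd (xs.map (rowT q s)) lam ν * matProd (ys.map (rowTstar q s)) ν mu) ∧
    (ys.map fun y => (xs.map fun x => 1 - x * y).prod).prod *
        ∑' κ, matProd (ys.map (rowTstar q s)) lam κ * matProd (xs.map (rowT q s)) κ mu =
      (ys.map fun y => (xs.map fun x => 1 - q * x * y).prod).prod *
        ∑' ν, matProd (xs.map (rowT q s)) lam ν * matProd (ys.map (rowTstar q s)) ν mu := by
  have hA : ∀ A ∈ xs.map (rowT q s), SizeLowers A := by
    intro A hA
    obtain ⟨x, hx, rfl⟩ := List.mem_map.1 hA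
    exact (hxs x hx).sizeLowers
  have hB : ∀ B ∈ ys.map (rowTstar q s), SizeRaises B := by
    intro B hB
    obtain ⟨y, hy, rfl⟩ := List.mem_map.1 hB
    exact (hys y hy).sizeRaises
  have hδ := finite_support_delta mu
  have hf := appList_matProd_lowers hA mu
  have hd := decay_appList_rowT (q := q) hu hxs (Decay.of_finite_support hu hδ)
  refine ⟨?_, ?_, ?_⟩
  · rw [hf] at hd
    refine Summable.of_norm ?_
    simpa only [norm_mul] using
      (decay_matProd_rowTstar (q := q) hv hys lam).summable_norm_mul hu hv huv hd
  · refine summable_of_hasFiniteSupport ((finite_size_le lam.1).subset fun ν hν => ?_)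
    exact sizeLowers_matProd hA lam ν (left_ne_zero_of_mul hν)
  · have h := tsum_matProd_appList (q := q) hu hv huv hxs hys hδ lam
    rw [hf, appList_matProd_raises hB] at h
    rw [h, tsum_matProd_lowers hA]

/-- Take `u` and `v` to be the two maxima; they are attained at some `i` and `j`, and the hypothesis
for this pair gives `u * v < 1`. -/
theorem exists_adm {m n : ℕ} [NeZero m] [NeZero n] {x : Fin m → ℂ} {y : Fin n → ℂ}
    (hadm : ∀ i j, ‖(x i - s) * (y j - s)‖ < ‖(1 - s * x i) * (1 - s * y j)‖) :
    ∃ u v : ℝ, 0 ≤ u ∧ 0 ≤ v ∧ u * v < 1 ∧ (∀ i, Adm s u (x i)) ∧ ∀ j, Adm s v (y j) := by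
  have hne : ∀ i j, (1 - s * x i) * (1 - s * y j) ≠ 0 := fun i j =>
    norm_pos_iff.1 ((norm_nonneg _).trans_lt (hadm i j))
  obtain ⟨i, hi⟩ := Finite.exists_max fun i => ‖(x i - s) / (1 - s * x i)‖
  obtain ⟨j, hj⟩ := Finite.exists_max fun j => ‖(y j - s) / (1 - s * y j)‖
  refine ⟨_, _, norm_nonneg _, norm_nonneg _, ?_,
    fun i' => ⟨left_ne_zero_of_mul (hne i' j), hi i'⟩,
    fun j' => ⟨right_ne_zero_of_mul (hne i j'), hj j'⟩⟩
  rw [← norm_mul, div_mul_div_comm, norm_div, div_lt_one (norm_pos_iff.2 (hne i j))]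
  exact hadm i j

end

end SSHL

theorem theorem3p1 (q s : ℂ) {m n : ℕ} (x : Fin m → ℂ) (y : Fin n → ℂ)
    (hadm : ∀ i j, ‖(x i - s) * (y j - s)‖ < ‖(1 - s * x i) * (1 - s * y j)‖)
    (hq : ∀ i j, 1 - q * x i * y j ≠ 0)
    (lam mu : SSHL.Ptn) :
    Summable (fun κ : SSHL.Ptn => SSHL.skewG q s κ lam y * SSHL.skewF q s κ mu x) ∧
    Summable (fun ν : SSHL.Ptn => SSHL.skewF q s lam ν x * SSHL.skewG q s mu ν y) ∧
    (∏ i, ∏ j, (1 - x i * y j) / (1 - q * x i * y j)) *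
        ∑' κ : SSHL.Ptn, SSHL.skewG q s κ lam y * SSHL.skewF q s κ mu x =
      ∑' ν : SSHL.Ptn, SSHL.skewF q s lam ν x * SSHL.skewG q s mu ν y := by
  -- With no variables on one side the convergence condition is vacuous, but that side is then a
  -- Kronecker delta and both sums have a single term.
  rcases Nat.eq_zero_or_pos m with rfl | hm
  · have hF : ∀ κ τ : SSHL.Ptn, κ ≠ τ → SSHL.skewF q s κ τ x = 0 := fun κ τ h => by
      simp [SSHL.skewF, SSHL.matProd, h]
    have h1 : ∀ κ : SSHL.Ptn, SSHL.skewF q s κ κ x = 1 := fun κ => by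
      simp [SSHL.skewF, SSHL.matProd]
    have e1 := hasSum_single (f := fun κ => SSHL.skewG q s κ lam y * SSHL.skewF q s κ mu x) mu
      fun κ hκ => by simp [hF κ mu hκ]
    have e2 := hasSum_single (f := fun ν => SSHL.skewF q s lam ν x * SSHL.skewG q s mu ν y) lam
      fun κ hκ => by simp [hF lam κ hκ.symm]
    refine ⟨e1.summable, e2.summable, ?_⟩
    rw [e1.tsum_eq, e2.tsum_eq]
    simp [h1]
  rcases Nat.eq_zero_or_pos n with rfl | hn
  · have hG : ∀ κ τ : SSHL.Ptn, κ ≠ τ → SSHL.skewG q s κ τ y = 0 := fun κ τ h => by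
      simp [SSHL.skewG, SSHL.matProd, h.symm]
    have h1 : ∀ κ : SSHL.Ptn, SSHL.skewG q s κ κ y = 1 := fun κ => by
      simp [SSHL.skewG, SSHL.matProd]
    have e1 := hasSum_single (f := fun κ => SSHL.skewG q s κ lam y * SSHL.skewF q s κ mu x) lam
      fun κ hκ => by simp [hG κ lam hκ]
    have e2 := hasSum_single (f := fun ν => SSHL.skewF q s lam ν x * SSHL.skewG q s mu ν y) mu
      fun κ hκ => by simp [hG mu κ hκ.symm]
    refine ⟨e1.summable, e2.summable, ?_⟩
    rw [e1.tsum_eq, e2.tsum_eq]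
    simp [h1]
  have : NeZero m := ⟨hm.ne'⟩
  have : NeZero n := ⟨hn.ne'⟩
  obtain ⟨u, v, hu, hv, huv, hx, hy⟩ := SSHL.exists_adm hadm
  have hprod : ∀ f : ℂ → ℂ → ℂ, ((List.ofFn y).map fun b =>
      ((List.ofFn x).reverse.map fun a => f a b).prod).prod = ∏ i, ∏ j, f (x i) (y j) := by
    intro f
    rw [Finset.prod_comm]
    simp [List.map_reverse, List.prod_reverse, List.map_ofFn, List.prod_ofFn]
  obtain ⟨h1, h2, h3⟩ := SSHL.skew_cauchy_of_adm (q := q) (xs := (List.ofFn x).reverse)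
    (ys := List.ofFn y) hu hv huv
    (fun a ha => by
      obtain ⟨i, rfl⟩ := (List.mem_ofFn' _ _).1 (List.mem_reverse.1 ha)
      exact hx i)
    (fun b hb => by
      obtain ⟨j, rfl⟩ := (List.mem_ofFn' _ _).1 hb
      exact hy j) lam mu
  rw [hprod fun a b => 1 - a * b, hprod fun a b => 1 - q * a * b] at h3
  refine ⟨h1, h2, ?_⟩
  simp only [Finset.prod_div_distrib]
  rw [div_mul_eq_mul_div, div_eq_iff (Finset.prod_ne_zero_iff.2 fun i _ =>
    Finset.prod_ne_zero_iff.2 fun j _ => hq i j)]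
  exact h3.trans (mul_comm _ _)
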